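/- Let $\mathbf F_r$ be the free group with basis $B=\{x_1,\dots,x_r\}$, let $\ell\ge 1$, and let $w_1,\dots,w_\ell\in\mathbf F_r\setminus\{1\}$, written as reduced words, be balanced: for every $x\in B$ the total number $L_x$ of letters $x^{+1}$ in $w_1,\dots,w_\ell$ equals the total number of letters $x^{-1}$. Put $$\mathcal Tr_{w_1,\dots,w_\ell}(n)=\int_{\mathcal U(n)^r}\mathrm{tr}\,w_1(A_1,\dots,A_r)\cdots\mathrm{tr}\,w_\ell(A_1,\dots,A_r)\,d\mu ,$$ where $\mu$ is the product of the Haar probability measures on the unitary group $\mathcal U(n)$. Let $\overline{\mathrm{MATCH}}^{*}$ be the set of all tuples $\sigma=(\kappa_x;\sigma_{x,0},\dots,\sigma_{x,\kappa_x})_{x\in B}$, where $\kappa_x=\kappa_x(\sigma)\in\mathbb Z_{\ge0}$ is arbitrary, each $\sigma_{x,j}$ is a bijection from the letters $x^{+1}$ to the letters $x^{-1}$ of $w_1,\dots,w_\ell$, and $\sigma_{x,j}\ne\sigma_{x,j+1}$ for all $x\in B$ and $0\le j<\kappa_x$. Put $|\kappa(\sigma)|=\sum_{x\in B}\kappa_x(\sigma)$,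 and let $\chi(\sigma)$ be the Euler characteristic (the alternating number of cells) of the following cell complex $\Sigma_\sigma$. For each $i$ take an oriented circle $S^1(w_i)$ with $|w_i|$ marked points, called $o$-points, which cut it into $|w_i|$ intervals corresponding, in cyclic order, to the letters of $w_i$. On the interval of a letter $x^{\pm1}$ mark $\kappa_x+1$ further points, labelled $(x,0),\dots,(x,\kappa_x)$ in the order of the orientation for $x^{+1}$ and in the reverse order for $x^{-1}$. All marked points are vertices, and the arcs between consecutive marked points are edges. For every letter $\lambda=x^{+1}$ and every $0\le j\le\kappa_x$ add an edge (a matching-edge) joining the $(x,j)$-point of $\lambda$ to the $(x,j)$-point of $\sigma_{x,j}(\lambda)$. Finally glue a disc along each cycle obtained by repeatedly moving along a circle, in the direction of its orientation, up to the next labelled point and then crossing the matching-edge at that point. Then for every $\chi_0\in\mathbb Z$ there are only finitely many $\sigma\in\overline{\mathrm{MATCH}}^{*}$ with $\chi(\sigma)=\chi_0$, and for every integer $n$ with $n\ge L_x$ for all $x\in B$, $$\mathcal Tr_{w_1,\dots,w_\ell}(n)=\sum_{\sigma\in\overline{\mathrm{MATCH}}^{*}}(-1)^{|\kappa(\sigma)|}\,n^{\chi(\sigma)}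 ,$$ where the infinite sum is understood as a Laurent series in $1/n$, that is, as the absolutely convergent series $\sum_{\chi_0\in\mathbb Z}\Bigl(\sum_{\sigma:\ \chi(\sigma)=\chi_0}(-1)^{|\kappa(\sigma)|}\Bigr)n^{\chi_0}$. -/

import Mathlib

open MeasureTheory

namespace WordIntegral

/-! ### Expected products of traces over the unitary groups -/

/-- The compact group `U(n)` of complex unitary `n × n` matrices. -/
abbrev U (n : ℕ) : Type := Matrix.unitaryGroup (Fin n) ℂ

noncomputable instance instMeasurableSpaceU (n : ℕ) : MeasurableSpace (U n) := borel (U n)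

instance instBorelSpaceU (n : ℕ) : BorelSpace (U n) := ⟨rfl⟩

instance instCompactSpaceU (n : ℕ) : CompactSpace (U n) := by
  refine isCompact_iff_compactSpace.mp
    (?_ : IsCompact (Matrix.unitaryGroup (Fin n) ℂ : Set (Matrix (Fin n) (Fin n) ℂ)))
  have hK : IsCompact (Set.univ.pi fun _ : Fin n => Set.univ.pi fun _ : Fin n =>
      Metric.closedBall (0 : ℂ) 1) :=
    isCompact_univ_pi fun _ => isCompact_univ_pi fun _ => isCompact_closedBall _ _
  refine IsCompact.of_isClosed_subset hK (isClosed_unitary (R := Matrix (Fin n) (Fin n) ℂ)) ?_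
  exact fun A hA i _ j _ => mem_closedBall_zero_iff.mpr (entry_norm_bound_of_unitary hA i j)

/-- The Haar probability measure on `U(n)`. -/
noncomputable def haarU (n : ℕ) : Measure (U n) := Measure.haarMeasure ⊤

instance instIsProbabilityMeasureHaarU (n : ℕ) : IsProbabilityMeasure (haarU n) :=
  ⟨Measure.haarMeasure_self⟩

/-- The value `w(A₁, …, A_r)` of a word `w` in the free group. -/
def evalWord {r n : ℕ} (A : Fin r → U n) (w : FreeGroup (Fin r)) : U n :=
  FreeGroup.lift A w

/-- The expectation of `tr(w₁(A₁, …, A_r)) ⋯ tr(w_ℓ(A₁, …, A_r))` for independent Haar-random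
unitary matrices `A₁, …, A_r ∈ U(n)`. -/
noncomputable def expTrace {r ℓ : ℕ} (w : Fin ℓ → FreeGroup (Fin r)) (n : ℕ) : ℂ :=
  ∫ A : Fin r → U n, ∏ i : Fin ℓ, Matrix.trace (evalWord A (w i)).1
    ∂(Measure.pi fun _ : Fin r => haarU n)

/-! ### Two-dimensional cell complexes -/

/-- A two-dimensional cell complex, given by its `1`-skeleton (a graph with a reference orientation
of each edge) together with the attaching maps of its `2`-cells.  A dart is a directed edge
occurring in the boundary of a disc (`(e, true)` is the edge `e` traversed from its source to its
target, `(e, false)` is `e` traversed backwards).  The permutation `next` sends a dart to the one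
following it on the boundary of the same disc; its cycles are therefore closed edge paths, and one
disc is glued along each of them. -/
structure CellComplex where
  Vertex : Type
  Edge : Type
  source : Edge → Vertex
  target : Edge → Vertex
  Dart : Type
  traverse : Dart → Edge × Bool
  next : Equiv.Perm Dart
  next_start : ∀ d,
    (if (traverse (next d)).2 then source (traverse (next d)).1
      else target (traverse (next d)).1) =
    (if (traverse d).2 then target (traverse d).1 else source (traverse d).1)

/-- The `2`-cells: the cycles (fixed points included) of `next`. -/
def CellComplex.Face (C : CellComplex) : Type :=
  Quotient (Equiv.Perm.SameCycle.setoid C.next)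

/-- The Euler characteristic: the alternating sum of the numbers of cells. -/
noncomputable def CellComplex.eulerChar (C : CellComplex) : ℤ :=
  (Nat.card C.Vertex : ℤ) - Nat.card C.Edge + Nat.card C.Face

/-! ### Letters and matchings -/

section Letters

variable {r ℓ : ℕ} (w : Fin ℓ → FreeGroup (Fin r))

/-- The letters of the (reduced) words `w₁, …, w_ℓ`, i.e. the pairs (word, position in it). -/
abbrev Letter : Type := Σ i : Fin ℓ, Fin (w i).toWord.length

/-- The generator `x` and the sign of a letter: `(x, true)` for `x⁺¹`, `(x, false)` for `x⁻¹`. -/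
def letterVal (p : Letter w) : Fin r × Bool := (w p.1).toWord.get p.2

/-- The instances of `x⁺¹` in `w₁, …, w_ℓ`. -/
abbrev PosLetter (x : Fin r) : Type := {p : Letter w // letterVal w p = (x, true)}

/-- The instances of `x⁻¹` in `w₁, …, w_ℓ`. -/
abbrev NegLetter (x : Fin r) : Type := {p : Letter w // letterVal w p = (x, false)}

/-- `L_x`, the number of instances of `x⁺¹`. -/
def letterCount (x : Fin r) : ℕ := Fintype.card (PosLetter w x)

/-- The words are balanced if each `x⁺¹` occurs in total as often as `x⁻¹`. -/
def Balanced : Prop := ∀ x : Fin r, Fintype.card (PosLetter w x) = Fintype.card (NegLetter w x)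

/-- Bijections from the instances of `x⁺¹` to the instances of `x⁻¹`. -/
abbrev Matching (x : Fin r) : Type := PosLetter w x ≃ NegLetter w x

/-- Tuples consisting of `κ x + 1` matchings `σ x 0, …, σ x (κ x)` for every generator `x`. -/
abbrev MatchTuple (κ : Fin r → ℕ) : Type := (x : Fin r) → Fin (κ x + 1) → Matching w x

/-- All tuples of matchings, with arbitrary `κ`, whose adjacent matchings are distinct. -/
structure RestrictedTuple where
  κ : Fin r → ℕ
  σ : MatchTuple w κ
  adjacent_ne : ∀ (x : Fin r) (j : Fin (κ x)), σ x j.castSucc ≠ σ x j.succ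

end Letters

/-! ### The surface of a tuple of matchings -/

section Surface

variable {r ℓ : ℕ} {w : Fin ℓ → FreeGroup (Fin r)} {κ : Fin r → ℕ}

/-- The `z`-points: for each generator `x` and each `j = 0, …, κ x`, there is one `(x, j)`-point on
the interval of each letter `x⁺¹` and of each letter `x⁻¹`. -/
abbrev ZPoint (w : Fin ℓ → FreeGroup (Fin r)) (κ : Fin r → ℕ) : Type :=
  Σ x : Fin r, Fin (κ x + 1) × (PosLetter w x ⊕ NegLetter w x)

/-- The marked points of the circles `S¹(w₁), …, S¹(w_ℓ)`: the `o`-points (`Sum.inl p` is the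
`o`-point at which the interval of the letter `p` begins) and the `z`-points. -/
abbrev Point (w : Fin ℓ → FreeGroup (Fin r)) (κ : Fin r → ℕ) : Type :=
  Letter w ⊕ ZPoint w κ

/-- The letter following a given one in the cyclic order of its word. -/
def nextLetter (w : Fin ℓ → FreeGroup (Fin r)) : Equiv.Perm (Letter w) :=
  Equiv.sigmaCongrRight fun i => finRotate (w i).toWord.length

/-- The first `z`-point on the interval of a letter: the `(x, 0)`-point for a letter `x⁺¹`,
the `(x, κ x)`-point for a letter `x⁻¹`. -/
def firstZ (w : Fin ℓ → FreeGroup (Fin r)) (κ : Fin r → ℕ) (p : Letter w) : ZPoint w κ :=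
  if h : (letterVal w p).2 = true then
    ⟨(letterVal w p).1, 0, Sum.inl ⟨p, Prod.ext rfl h⟩⟩
  else
    ⟨(letterVal w p).1, Fin.last _, Sum.inr ⟨p, Prod.ext rfl (Bool.eq_false_iff.mpr h)⟩⟩

/-- The last `z`-point on the interval of a letter: the `(x, κ x)`-point for a letter `x⁺¹`,
the `(x, 0)`-point for a letter `x⁻¹`. -/
def lastZ (w : Fin ℓ → FreeGroup (Fin r)) (κ : Fin r → ℕ) (p : Letter w) : ZPoint w κ :=
  if h : (letterVal w p).2 = true then
    ⟨(letterVal w p).1, Fin.last _, Sum.inl ⟨p, Prod.ext rfl h⟩⟩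
  else
    ⟨(letterVal w p).1, 0, Sum.inr ⟨p, Prod.ext rfl (Bool.eq_false_iff.mpr h)⟩⟩

/-- The next marked point along the oriented circle. -/
def succPoint : Point w κ → Point w κ
  | Sum.inl p => Sum.inr (firstZ w κ p)
  | Sum.inr ⟨x, j, Sum.inl p⟩ =>
      Fin.lastCases (motive := fun _ => Point w κ) (Sum.inl (nextLetter w p.1))
        (fun i => Sum.inr ⟨x, i.succ, Sum.inl p⟩) j
  | Sum.inr ⟨x, j, Sum.inr q⟩ =>
      Fin.cases (motive := fun _ => Point w κ) (Sum.inl (nextLetter w q.1))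
        (fun i => Sum.inr ⟨x, i.castSucc, Sum.inr q⟩) j

/-- The previous marked point along the oriented circle. -/
def predPoint : Point w κ → Point w κ
  | Sum.inl p => Sum.inr (lastZ w κ ((nextLetter w).symm p))
  | Sum.inr ⟨x, j, Sum.inl p⟩ =>
      Fin.cases (motive := fun _ => Point w κ) (Sum.inl p.1)
        (fun i => Sum.inr ⟨x, i.castSucc, Sum.inl p⟩) j
  | Sum.inr ⟨x, j, Sum.inr q⟩ =>
      Fin.lastCases (motive := fun _ => Point w κ) (Sum.inl q.1)
        (fun i => Sum.inr ⟨x, i.succ, Sum.inr q⟩) j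

theorem firstZ_pos {x : Fin r} (p : PosLetter w x) : firstZ w κ p.1 = ⟨x, 0, Sum.inl p⟩ := by
  obtain ⟨p, hp⟩ := p
  obtain rfl : (letterVal w p).1 = x := by rw [hp]
  have h : (letterVal w p).2 = true := by rw [hp]
  simp [firstZ, h]

theorem firstZ_neg {x : Fin r} (p : NegLetter w x) :
    firstZ w κ p.1 = ⟨x, Fin.last _, Sum.inr p⟩ := by
  obtain ⟨p, hp⟩ := p
  obtain rfl : (letterVal w p).1 = x := by rw [hp]
  have h : (letterVal w p).2 = false := by rw [hp]
  simp [firstZ, h]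

theorem lastZ_pos {x : Fin r} (p : PosLetter w x) :
    lastZ w κ p.1 = ⟨x, Fin.last _, Sum.inl p⟩ := by
  obtain ⟨p, hp⟩ := p
  obtain rfl : (letterVal w p).1 = x := by rw [hp]
  have h : (letterVal w p).2 = true := by rw [hp]
  simp [lastZ, h]

theorem lastZ_neg {x : Fin r} (p : NegLetter w x) : lastZ w κ p.1 = ⟨x, 0, Sum.inr p⟩ := by
  obtain ⟨p, hp⟩ := p
  obtain rfl : (letterVal w p).1 = x := by rw [hp]
  have h : (letterVal w p).2 = false := by rw [hp]
  simp [lastZ, h]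

theorem letter_cases (p : Letter w) :
    (∃ (x : Fin r) (q : PosLetter w x), q.1 = p) ∨ ∃ (x : Fin r) (q : NegLetter w x), q.1 = p := by
  rcases h : letterVal w p with ⟨x, _ | _⟩
  · exact Or.inr ⟨x, ⟨p, h⟩, rfl⟩
  · exact Or.inl ⟨x, ⟨p, h⟩, rfl⟩

theorem predPoint_succPoint (a : Point w κ) : predPoint (succPoint a) = a := by
  rcases a with p | ⟨x, j, p | q⟩
  · rcases letter_cases p with ⟨x, q, rfl⟩ | ⟨x, q, rfl⟩
    · simp [succPoint, predPoint, firstZ_pos]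
    · simp [succPoint, predPoint, firstZ_neg]
  · cases j using Fin.lastCases with
    | last => simp [succPoint, predPoint, lastZ_pos]
    | cast i => simp [succPoint, predPoint]
  · cases j using Fin.cases with
    | zero => simp [succPoint, predPoint, lastZ_neg]
    | succ i => simp [succPoint, predPoint]

theorem succPoint_predPoint (a : Point w κ) : succPoint (predPoint a) = a := by
  rcases a with p | ⟨x, j, p | q⟩
  · obtain ⟨p, rfl⟩ := (nextLetter w).surjective p
    rcases letter_cases p with ⟨x, q, rfl⟩ | ⟨x, q, rfl⟩
    · simp [succPoint, predPoint, lastZ_pos]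
    · simp [succPoint, predPoint, lastZ_neg]
  · cases j using Fin.cases with
    | zero => simp [succPoint, predPoint, firstZ_pos]
    | succ i => simp [succPoint, predPoint]
  · cases j using Fin.lastCases with
    | last => simp [succPoint, predPoint, firstZ_neg]
    | cast i => simp [succPoint, predPoint]

/-- The other endpoint of the matching-edge at a `z`-point: an `(x, j)`-point is joined to another
`(x, j)`-point by the matching `σ x j`. -/
def partner (σ : MatchTuple w κ) : ZPoint w κ → ZPoint w κ
  | ⟨x, j, Sum.inl p⟩ => ⟨x, j, Sum.inr (σ x j p)⟩
  | ⟨x, j, Sum.inr q⟩ => ⟨x, j, Sum.inl ((σ x j).symm q)⟩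

theorem partner_partner (σ : MatchTuple w κ) (z : ZPoint w κ) :
    partner σ (partner σ z) = z := by
  rcases z with ⟨x, j, p | q⟩ <;> simp [partner]

/-- The edges: `Sum.inl a` is the arc of a circle from the marked point `a` to the next one;
`Sum.inr ⟨x, j, p⟩` is the matching-edge of `σ x j` at the letter `p`. -/
abbrev SurfaceEdge (w : Fin ℓ → FreeGroup (Fin r)) (κ : Fin r → ℕ) : Type :=
  Point w κ ⊕ (Σ x : Fin r, Fin (κ x + 1) × PosLetter w x)

/-- The directed edges met by the boundaries of discs: `Sum.inl a` is the arc starting at `a`,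
always followed along the orientation of the circle; `Sum.inr z` is the matching-edge at `z`,
followed starting from `z`. -/
abbrev SurfaceDart (w : Fin ℓ → FreeGroup (Fin r)) (κ : Fin r → ℕ) : Type :=
  Point w κ ⊕ ZPoint w κ

/-- The edge under a dart, and the direction in which the dart follows it. -/
def traverseDart (σ : MatchTuple w κ) : SurfaceDart w κ → SurfaceEdge w κ × Bool
  | Sum.inl a => (Sum.inl a, true)
  | Sum.inr ⟨x, j, Sum.inl p⟩ => (Sum.inr ⟨x, j, p⟩, true)
  | Sum.inr ⟨x, j, Sum.inr q⟩ => (Sum.inr ⟨x, j, (σ x j).symm q⟩, false)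

/-- How the boundary of a disc continues: along the circle until the next `z`-point, then over the
matching-edge emanating from it, then again along the circle. -/
def nextDart (σ : MatchTuple w κ) : SurfaceDart w κ → SurfaceDart w κ
  | Sum.inl a => Sum.elim (fun p => Sum.inl (Sum.inl p)) (fun z => Sum.inr z) (succPoint a)
  | Sum.inr z => Sum.inl (Sum.inr (partner σ z))

/-- The inverse of `nextDart`. -/
def prevDart (σ : MatchTuple w κ) : SurfaceDart w κ → SurfaceDart w κ
  | Sum.inl (Sum.inl p) => Sum.inl (predPoint (Sum.inl p))
  | Sum.inl (Sum.inr z) => Sum.inr (partner σ z)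
  | Sum.inr z => Sum.inl (predPoint (Sum.inr z))

theorem prevDart_nextDart (σ : MatchTuple w κ) (d : SurfaceDart w κ) :
    prevDart σ (nextDart σ d) = d := by
  rcases d with a | z
  · have ha := predPoint_succPoint a
    rcases h : succPoint a with p | z <;> rw [h] at ha <;>
      simp [nextDart, prevDart, h, ha]
  · simp [nextDart, prevDart, partner_partner]

theorem nextDart_prevDart (σ : MatchTuple w κ) (d : SurfaceDart w κ) :
    nextDart σ (prevDart σ d) = d := by
  rcases d with (p | z) | z <;>
    simp [nextDart, prevDart, succPoint_predPoint, partner_partner]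

/-- The surface obtained from a tuple of matchings, as a cell complex: its vertices are the marked
points, its edges are the arcs between consecutive marked points on the circles
`S¹(w₁), …, S¹(w_ℓ)` and the matching-edges, and one disc is glued along each of the cycles
described by `nextDart`. -/
def surface (σ : MatchTuple w κ) : CellComplex where
  Vertex := Point w κ
  Edge := SurfaceEdge w κ
  source := Sum.elim id fun e => Sum.inr ⟨e.1, e.2.1, Sum.inl e.2.2⟩
  target := Sum.elim succPoint fun e => Sum.inr ⟨e.1, e.2.1, Sum.inr (σ e.1 e.2.1 e.2.2)⟩
  Dart := SurfaceDart w κ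
  traverse := traverseDart σ
  next := ⟨nextDart σ, prevDart σ, prevDart_nextDart σ, nextDart_prevDart σ⟩
  next_start := by
    rintro (a | ⟨x, j, p | q⟩)
    · rcases h : succPoint a with p | ⟨x, j, p | q⟩ <;> simp [nextDart, traverseDart, h]
    · simp [nextDart, traverseDart, partner]
    · simp [nextDart, traverseDart, partner]

/-- The Euler characteristic `χ(σ)` of the surface of a restricted tuple of matchings. -/
noncomputable def RestrictedTuple.chi (s : RestrictedTuple w) : ℤ := (surface s.σ).eulerChar

/-- `|κ(σ)|`, the sum of the numbers `κ x` over all generators `x`. -/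
def RestrictedTuple.absKappa (s : RestrictedTuple w) : ℕ := ∑ x, s.κ x

end Surface

end WordIntegral

/-! Expanding the traces turns the integral into a sum over all labellings of the `o`-points by
indices in `Fin n`, each term being a product over the generators of mixed moments of one Haar
unitary. Left invariance makes such a moment, as a matrix in its row indices, commute with every
tensor power of a unitary, hence (as $L_x\le n$) a combination of permutation operators
(`CommutesWithUnitary.exists_eq_sum`). Contracting row indices gives a linear system whose matrix is
$n^{L_x}$ times `lengthMatrix`, the matrix $X^{|\alpha^{-1}\beta|}$ at $X=1/n$; its inverse $W$
gives the moments (`haarMoment_eq`). Summing over labellings leaves $n$ to the number of cycles of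
`outerPerm`, for each pair of matchings $(\alpha,\beta)$ (`expTrace_eq`).

The series $W$ is examined in two ways. Analytically, $\sum_\sigma X^{|\sigma|}\sigma$ factors into
$1+XJ_k$, where $J_k$ is a sum of $k-1$ transpositions; each factor has a Neumann series inverse
converging absolutely at $1/n$ because $k-1<L_x\le n$. Formally, with $E$ the off-diagonal part of
`lengthMatrix`, $W=\sum_k(-E)^k$, whose entries are signed sums over sequences of matchings with
distinct neighbours. The second expansion is used only coefficient by coefficient, so its own
convergence at $1/n$ never matters. All series live in `summableSeries`, where both descriptions
concern the same inverse.

Finally, the discs of the surface are those through `o`-points, counted by `outerPerm`, and those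
between consecutive matchings, counted by `innerPerm`. Hence $\chi(\sigma)$ is the number of outer
cycles minus $\sum_x L_x$ minus the total length of the sequence (`eulerChar_surface`), which is
exactly the exponent of $n$ produced by the integral. -/

namespace WordIntegral

/-! ### Numbers of cycles -/

section Cycles

variable {α β : Type*}

/-- The number of cycles of a permutation, fixed points included. -/
noncomputable def cycleCount (σ : Equiv.Perm α) : ℕ :=
  Nat.card (Quotient (Equiv.Perm.SameCycle.setoid σ))

/-- The functions that are constant along the cycles of a permutation. -/
abbrev InvFun (σ : Equiv.Perm α) (N : Type*) : Type _ := {f : α → N // ∀ a, f (σ a) = f a}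

theorem InvFun.zpow_apply {N : Type*} {σ : Equiv.Perm α} (f : InvFun σ N) (k : ℤ) (a : α) :
    f.1 ((σ ^ k) a) = f.1 a := by
  induction k using Int.induction_on generalizing a with
  | zero => simp
  | succ k ih => rw [zpow_add, zpow_one, Equiv.Perm.mul_apply, ih, f.2]
  | pred k ih =>
    rw [zpow_sub, zpow_one, Equiv.Perm.mul_apply, ih]
    simpa using (f.2 (σ⁻¹ a)).symm

/-- Invariant functions are functions on the set of cycles. -/
def invFunEquiv (σ : Equiv.Perm α) (N : Type*) :
    InvFun σ N ≃ (Quotient (Equiv.Perm.SameCycle.setoid σ) → N) where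
  toFun f := Quotient.lift f.1 (by
    rintro a _ ⟨k, rfl⟩
    exact (f.zpow_apply k a).symm)
  invFun g := ⟨fun a => g (Quotient.mk _ a), fun a => congrArg g (Quotient.sound ⟨-1, by simp⟩)⟩
  left_inv f := rfl
  right_inv g := by
    ext q
    induction q using Quotient.inductionOn
    rfl

theorem card_invFun [Finite α] (σ : Equiv.Perm α) (N : Type*) :
    Nat.card (InvFun σ N) = Nat.card N ^ cycleCount σ := by
  rw [Nat.card_congr (invFunEquiv σ N), Nat.card_fun, cycleCount]

/-- Cycles are counted through invariant two-colourings: bijections between sets of colourings are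
easier to write down than bijections between quotients. -/
theorem cycleCount_eq_of_card [Finite α] {σ : Equiv.Perm α} {k : ℕ}
    (h : Nat.card (InvFun σ Bool) = 2 ^ k) : cycleCount σ = k := by
  rw [card_invFun, Nat.card_eq_fintype_card, Fintype.card_bool] at h
  exact Nat.pow_right_injective le_rfl h

theorem cycleCount_congr [Finite α] [Finite β] {σ : Equiv.Perm α} {τ : Equiv.Perm β}
    (e : InvFun σ Bool ≃ InvFun τ Bool) : cycleCount σ = cycleCount τ :=
  cycleCount_eq_of_card (by
    rw [Nat.card_congr e, card_invFun, Nat.card_eq_fintype_card, Fintype.card_bool])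

theorem cycleCount_le_card [Finite α] (σ : Equiv.Perm α) : cycleCount σ ≤ Nat.card α :=
  Nat.card_le_card_of_surjective (Quotient.mk (Equiv.Perm.SameCycle.setoid σ)) Quotient.mk_surjective

theorem cycleCount_lt_card [Finite α] {σ : Equiv.Perm α} (h : σ ≠ 1) :
    cycleCount σ < Nat.card α := by
  refine lt_of_le_of_ne (cycleCount_le_card σ) fun hc => h ?_
  have hb := Function.Surjective.bijective_of_nat_card_le
    (f := Quotient.mk (Equiv.Perm.SameCycle.setoid σ)) Quotient.mk_surjective hc.ge
  ext a
  exact hb.1 (Quotient.sound ⟨-1, by simp⟩)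

theorem cycleCount_one [Finite α] : cycleCount (1 : Equiv.Perm α) = Nat.card α :=
  cycleCount_eq_of_card (by
    rw [Nat.card_congr (Equiv.subtypeUnivEquiv (p := fun f : α → Bool => ∀ a,
      f ((1 : Equiv.Perm α) a) = f a) (by simp)), Nat.card_fun]
    simp)

theorem cycleCount_inv [Finite α] (σ : Equiv.Perm α) : cycleCount σ⁻¹ = cycleCount σ :=
  cycleCount_congr (Equiv.subtypeEquivRight fun f =>
    ⟨fun h a => by simpa using (h (σ a)).symm, fun h a => by simpa using (h (σ⁻¹ a)).symm⟩)

theorem cycleCount_conj [Finite α] [Finite β] (e : α ≃ β) (σ : Equiv.Perm α) :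
    cycleCount (e.permCongr σ) = cycleCount σ :=
  cycleCount_congr ((Equiv.arrowCongr e.symm (Equiv.refl Bool)).subtypeEquiv fun f => by
    refine ⟨fun h a => by simpa using h (e a), fun h b => ?_⟩
    simpa using h (e.symm b))

theorem cycleCount_optionCongr [Finite α] (σ : Equiv.Perm α) :
    cycleCount (Equiv.optionCongr σ) = cycleCount σ + 1 := by
  refine cycleCount_eq_of_card ?_
  have e : InvFun (Equiv.optionCongr σ) Bool ≃ InvFun σ Bool × Bool :=
    { toFun := fun f => (⟨fun a => f.1 (some a), fun a => by simpa using f.2 (some a)⟩, f.1 none)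
      invFun := fun g => ⟨fun a => a.elim g.2 g.1.1, by rintro (_ | a) <;> simp [g.1.2]⟩
      left_inv := fun f => by ext (_ | a) <;> rfl
      right_inv := fun g => rfl }
  rw [Nat.card_congr e, Nat.card_prod, card_invFun]
  simp [pow_succ]

/-- Multiplying by the transposition inserts `none` into the cycle of `a`, just before `a`, so no
cycle is created or merged; an invariant function is determined by its values off `none`. -/
theorem cycleCount_swap_mul_optionCongr [Finite α] [DecidableEq α] (a : α) (σ : Equiv.Perm α) :
    cycleCount (Equiv.swap none (some a) * Equiv.optionCongr σ : Equiv.Perm (Option α)) =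
      cycleCount σ := by
  have key (i : α) : (Equiv.swap none (some a) * Equiv.optionCongr σ : Equiv.Perm (Option α))
      (some i) = if σ i = a then none else some (σ i) := by
    by_cases h : σ i = a <;> simp [h, Equiv.swap_apply_def]
  have key' : (Equiv.swap none (some a) * Equiv.optionCongr σ : Equiv.Perm (Option α)) none =
      some a := by simp
  refine cycleCount_congr
    { toFun := fun f => ⟨fun i => f.1 (some i), fun i => ?_⟩
      invFun := fun g => ⟨fun i => i.elim (g.1 a) g.1, ?_⟩
      left_inv := fun f => ?_
      right_inv := fun g => rfl }
  · have h := f.2 (some i)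
    have h' := f.2 none
    rw [key] at h
    rw [key'] at h'
    split_ifs at h with hi
    · beta_reduce; rw [hi, h', h]
    · exact h
  · rintro (_ | i)
    · rw [key']; rfl
    · rw [key]
      split_ifs with hi
      · simp [← g.2 i, hi]
      · simp [g.2]
  · ext (_ | i)
    · have h' := f.2 none
      rw [key'] at h'
      simpa using h'
    · rfl

/-- The length of a permutation: the number of points minus the number of cycles. -/
noncomputable def permLength (σ : Equiv.Perm α) : ℕ := Nat.card α - cycleCount σ

theorem permLength_add_cycleCount [Finite α] (σ : Equiv.Perm α) :
    permLength σ + cycleCount σ = Nat.card α :=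
  Nat.sub_add_cancel (cycleCount_le_card σ)

theorem permLength_one [Finite α] : permLength (1 : Equiv.Perm α) = 0 := by
  rw [permLength, cycleCount_one, Nat.sub_self]

theorem permLength_pos [Finite α] {σ : Equiv.Perm α} (h : σ ≠ 1) : 0 < permLength σ :=
  Nat.sub_pos_of_lt (cycleCount_lt_card h)

theorem permLength_conj [Finite α] [Finite β] (e : α ≃ β) (σ : Equiv.Perm α) :
    permLength (e.permCongr σ) = permLength σ := by
  rw [permLength, permLength, cycleCount_conj, Nat.card_congr e]

theorem permLength_optionCongr [Finite α] (σ : Equiv.Perm α) :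
    permLength (Equiv.optionCongr σ) = permLength σ := by
  rw [permLength, permLength, cycleCount_optionCongr, Finite.card_option, Nat.add_sub_add_right]

theorem permLength_swap_mul_optionCongr [Finite α] [DecidableEq α] (a : α) (σ : Equiv.Perm α) :
    permLength (Equiv.swap none (some a) * Equiv.optionCongr σ : Equiv.Perm (Option α)) =
      permLength σ + 1 := by
  have := cycleCount_le_card σ
  rw [permLength, permLength, cycleCount_swap_mul_optionCongr, Finite.card_option]
  omega

end Cycles

/-! ### Absolutely convergent power series -/

section SummableSeries

/-- The ring of the power series that converge absolutely at `t`. -/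
def summableSeries (t : ℂ) : Subring (PowerSeries ℂ) where
  carrier := {f | Summable fun k => ‖PowerSeries.coeff k f * t ^ k‖}
  mul_mem' {f g} hf hg := by
    have h := summable_norm_sum_mul_antidiagonal_of_summable_norm hf hg
    refine h.congr fun k => ?_
    rw [PowerSeries.coeff_mul, Finset.sum_mul]
    congr 1
    refine Finset.sum_congr rfl fun p hp => ?_
    rw [← Finset.HasAntidiagonal.mem_antidiagonal.1 hp, pow_add]
    ring
  one_mem' := summable_of_ne_finset_zero (s := {0}) fun k hk => by
    rw [Finset.mem_singleton] at hk
    simp [PowerSeries.coeff_one, hk]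
  add_mem' {f g} hf hg := by
    refine (Summable.add hf hg).of_nonneg_of_le (fun _ => norm_nonneg _) fun k => ?_
    rw [map_add, add_mul]
    exact norm_add_le _ _
  zero_mem' := by simp
  neg_mem' {f} hf := by simpa using hf

variable {t : ℂ}

theorem mem_summableSeries {f : PowerSeries ℂ} :
    f ∈ summableSeries t ↔ Summable fun k => ‖PowerSeries.coeff k f * t ^ k‖ := Iff.rfl

theorem summableSeries_summable (f : summableSeries t) :
    Summable fun k => PowerSeries.coeff k f.1 * t ^ k :=
  (mem_summableSeries.1 f.2).of_norm

/-- The value of a power series at `t`. -/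
noncomputable def evalSeries (t : ℂ) : summableSeries t →+* ℂ where
  toFun f := ∑' k, PowerSeries.coeff k f.1 * t ^ k
  map_one' := by
    rw [tsum_eq_single 0 fun k hk => by simp [PowerSeries.coeff_one, hk]]
    simp
  map_mul' f g := by
    rw [tsum_mul_tsum_eq_tsum_sum_antidiagonal_of_summable_norm f.2 g.2]
    refine tsum_congr fun k => ?_
    rw [Subring.coe_mul, PowerSeries.coeff_mul, Finset.sum_mul]
    refine Finset.sum_congr rfl fun p hp => ?_
    rw [← Finset.HasAntidiagonal.mem_antidiagonal.1 hp, pow_add]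
    ring
  map_zero' := by simp
  map_add' f g := by
    rw [← (summableSeries_summable f).tsum_add (summableSeries_summable g)]
    simp [add_mul]

theorem hasSum_evalSeries (f : summableSeries t) :
    HasSum (fun k => PowerSeries.coeff k f.1 * t ^ k) (evalSeries t f) :=
  (summableSeries_summable f).hasSum

theorem X_mem_summableSeries : (PowerSeries.X : PowerSeries ℂ) ∈ summableSeries t :=
  summable_of_ne_finset_zero (s := {1}) fun k hk => by
    rw [Finset.mem_singleton] at hk
    simp [PowerSeries.coeff_X, hk]

/-- The variable. -/
noncomputable def seriesX (t : ℂ) : summableSeries t := ⟨PowerSeries.X, X_mem_summableSeries⟩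

theorem evalSeries_X : evalSeries t (seriesX t) = t := by
  change ∑' k, PowerSeries.coeff k (PowerSeries.X : PowerSeries ℂ) * t ^ k = t
  rw [tsum_eq_single 1 fun k hk => by simp [PowerSeries.coeff_X, hk]]
  simp

/-- A power series whose coefficients grow at most geometrically. -/
theorem mk_mem_summableSeries {c : ℕ → ℂ} {m : ℝ} (hc : ∀ k, ‖c k‖ ≤ m ^ k)
    (hm : 0 ≤ m) (ht : m * ‖t‖ < 1) : PowerSeries.mk c ∈ summableSeries t := by
  refine (summable_geometric_of_lt_one (by positivity) ht).of_nonneg_of_le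
    (fun _ => norm_nonneg _) fun k => ?_
  rw [PowerSeries.coeff_mk, norm_mul, norm_pow, mul_pow]
  gcongr
  exact hc k

end SummableSeries

/-! ### Inverting the generating function of the permutations -/

section JucysMurphy

variable {t : ℂ}

/-- The sum of the products `s a₁ ⋯ s aₖ` in the group ring of a finite family `s`, by its
coefficients. -/
def powCoeff {G ι : Type*} [Group G] [DecidableEq G] [Fintype ι] (s : ι → G) : ℕ → G → ℂ
  | 0, g => if g = 1 then 1 else 0
  | k + 1, g => ∑ a, powCoeff s k ((s a)⁻¹ * g)

/-- The coefficient counts words of length `k` in the family with product `g`, among `card ι ^ k`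
words in all. -/
theorem norm_powCoeff_le {G ι : Type*} [Group G] [DecidableEq G] [Fintype ι] (s : ι → G) (k : ℕ)
    (g : G) : ‖powCoeff s k g‖ ≤ (Fintype.card ι : ℝ) ^ k := by
  induction k generalizing g with
  | zero =>
    rw [powCoeff]
    split_ifs <;> simp
  | succ k ih =>
    rw [powCoeff]
    refine (norm_sum_le_of_le _ fun a _ => ih _).trans ?_
    simp [pow_succ']

/-- The Neumann series inverts `1 + X ∑ₐ s a` in the group ring. -/
theorem exists_inverse_one_add_sum {G ι : Type*} [Group G] [Finite G] [Fintype ι] (s : ι → G)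
    (ht : Fintype.card ι * ‖t‖ < 1) :
    ∃ v : MonoidAlgebra (summableSeries t) G,
      (1 + ∑ a, MonoidAlgebra.single (s a) (seriesX t)) * v = 1 := by
  classical
  let c (g : G) : summableSeries t := ⟨PowerSeries.mk fun k => (-1) ^ k * powCoeff s k g,
    mk_mem_summableSeries (m := Fintype.card ι)
      (fun k => by simpa using norm_powCoeff_le s k g) (by positivity) ht⟩
  refine ⟨MonoidAlgebra.ofCoeff (Finsupp.equivFunOnFinite.symm c), ?_⟩
  rw [add_mul, one_mul, Finset.sum_mul]
  refine MonoidAlgebra.ext (Finsupp.ext fun g => Subtype.ext (PowerSeries.ext fun k => ?_))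
  simp only [MonoidAlgebra.coeff_add, MonoidAlgebra.coeff_sum, Finsupp.coe_add, Pi.add_apply,
    Finsupp.coe_finsetSum, Finset.sum_apply, MonoidAlgebra.coeff_single_mul_apply,
    MonoidAlgebra.one_def, MonoidAlgebra.coeff_single, Finsupp.single_apply,
    Finsupp.equivFunOnFinite_symm_apply_apply, Subring.coe_add, map_add,
    AddSubmonoidClass.coe_finsetSum, map_sum, Subring.coe_mul]
  -- Comparing coefficients of $X^k$: degree zero leaves only the identity, and in higher degree the
  -- recursion of `powCoeff` cancels against the alternating sign.
  cases k with
  | zero =>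
    simp [c, seriesX, powCoeff, eq_comm, apply_ite]
  | succ k =>
    simp [c, seriesX, powCoeff, eq_comm, apply_ite]
    rw [← Finset.mul_sum]
    ring

variable (t) in
/-- The generating function of the lengths of permutations. -/
noncomputable def lengthSeries (ι : Type*) [Fintype ι] [DecidableEq ι] :
    MonoidAlgebra (summableSeries t) (Equiv.Perm ι) :=
  ∑ σ : Equiv.Perm ι, MonoidAlgebra.single σ (seriesX t ^ permLength σ)

/-- `Equiv.optionCongr` as a homomorphism. -/
def optionCongrHom (ι : Type*) : Equiv.Perm ι →* Equiv.Perm (Option ι) where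
  toFun := Equiv.optionCongr
  map_one' := Equiv.optionCongr_one
  map_mul' σ τ := Equiv.ext (by rintro (_ | a) <;> rfl)

/-- The Jucys–Murphy factorization: each permutation of `Option ι` is uniquely `optionCongr σ`
preceded on the left by either the identity or one transposition `(none a)`, and only the latter
raises the length, by one. -/
theorem lengthSeries_option (ι : Type*) [Fintype ι] [DecidableEq ι] :
    lengthSeries t (Option ι) =
      (1 + ∑ a : ι, MonoidAlgebra.single (Equiv.swap none (some a)) (seriesX t)) *
        MonoidAlgebra.mapDomainRingHom (summableSeries t) (optionCongrHom ι)
          (lengthSeries t ι) := by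
  rw [lengthSeries, ← Equiv.sum_comp Equiv.Perm.decomposeOption.symm, Fintype.sum_prod_type,
    Fintype.sum_option, add_mul, one_mul, Finset.sum_mul, lengthSeries, map_sum]
  congr 1
  · refine Finset.sum_congr rfl fun σ _ => ?_
    simp [optionCongrHom, permLength_optionCongr, ← Equiv.Perm.one_def]
  · refine Finset.sum_congr rfl fun a _ => ?_
    rw [Finset.mul_sum]
    refine Finset.sum_congr rfl fun σ _ => ?_
    simp [optionCongrHom, permLength_swap_mul_optionCongr, MonoidAlgebra.single_mul_single,
      pow_succ']

/-- Induction on the number of points: adding a point to a set of `m` points contributes a factor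
with `m` transpositions, whose Neumann series needs `m * ‖t‖ < 1`. -/
theorem exists_lengthSeries_mul_eq_one (ι : Type*) [Fintype ι] [DecidableEq ι]
    (ht : ∀ m : ℕ, m < Fintype.card ι → m * ‖t‖ < 1) :
    ∃ v : MonoidAlgebra (summableSeries t) (Equiv.Perm ι), lengthSeries t ι * v = 1 := by
  revert ht
  have key := Fintype.induction_empty_option (P := fun (ι : Type _) _ => ∀ [DecidableEq ι],
    (∀ m : ℕ, m < Fintype.card ι → m * ‖t‖ < 1) →
    ∃ v : MonoidAlgebra (summableSeries t) (Equiv.Perm ι),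
      lengthSeries t ι * v = 1) ?_ ?_ ?_ ι
  · exact key
  · intro α β _ e ih _ ht
    let := Fintype.ofEquiv β e.symm
    let : DecidableEq α := e.injective.decidableEq
    obtain ⟨v, hv⟩ := ih (by rwa [Fintype.card_congr e])
    refine ⟨MonoidAlgebra.mapDomainRingHom (summableSeries t) e.permCongrHom.toMonoidHom v, ?_⟩
    rw [← map_one (MonoidAlgebra.mapDomainRingHom (summableSeries t) e.permCongrHom.toMonoidHom),
      ← hv, map_mul]
    congr 1
    rw [lengthSeries, lengthSeries, map_sum, ← Equiv.sum_comp e.permCongr]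
    refine Finset.sum_congr (by ext; simp) fun σ _ => ?_
    simp [permLength_conj]
  · intro _ _
    refine ⟨1, ?_⟩
    rw [mul_one, lengthSeries, Fintype.sum_subsingleton _ 1, MonoidAlgebra.one_def, permLength_one,
      pow_zero]
  · intro α _ ih _ ht
    let : DecidableEq α := (Option.some_injective α).decidableEq
    obtain ⟨v, hv⟩ := ih fun m hm => ht m (by rw [Fintype.card_option]; omega)
    obtain ⟨u, hu⟩ := exists_inverse_one_add_sum (t := t)
      (fun a : α => (Equiv.swap none (some a) : Equiv.Perm (Option α))) (ht _ (by simp))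
    -- The group algebra is not commutative, so the inverses of the two factors appear in reverse
    -- order.
    refine ⟨MonoidAlgebra.mapDomainRingHom (summableSeries t) (optionCongrHom α) v * u, ?_⟩
    have h : lengthSeries t (Option α) = (1 + ∑ a : α, MonoidAlgebra.single
      (Equiv.swap none (some a)) (seriesX t)) *
        MonoidAlgebra.mapDomainRingHom (summableSeries t) (optionCongrHom α)
          (lengthSeries t α) := by convert lengthSeries_option (t := t) α
    refine (congrArg (· * _) h).trans ?_
    rw [mul_assoc, ← mul_assoc (MonoidAlgebra.mapDomainRingHom _ _ _), ← map_mul, hv, map_one,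
      one_mul, hu]

variable (t) in
/-- The matrix `X ^ |α⁻¹β|`, indexed by the bijections between two finite types. -/
noncomputable def lengthMatrix (ι ι' : Type*) : Matrix (ι ≃ ι') (ι ≃ ι') (summableSeries t) :=
  Matrix.of fun α β => seriesX t ^ permLength (α.trans β.symm)

/-- An entry depends only on $\alpha^{-1}\beta$, so the matrix product is convolution in the group
algebra, and the coefficients of the inverse element supply the inverse matrix. -/
theorem exists_inverse_lengthMatrix (ι ι' : Type*) [Fintype ι] [DecidableEq ι] [Fintype ι']
    [DecidableEq ι'] (ht : ∀ m : ℕ, m < Fintype.card ι → m * ‖t‖ < 1) :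
    ∃ W : Matrix (ι ≃ ι') (ι ≃ ι') (summableSeries t), lengthMatrix t ι ι' * W = 1 := by
  obtain ⟨v, hv⟩ := exists_lengthSeries_mul_eq_one ι ht
  refine ⟨Matrix.of fun α β => v.coeff (β.trans α.symm), ?_⟩
  ext1 α γ
  let e : Equiv.Perm ι ≃ (ι ≃ ι') := Equiv.equivCongr (Equiv.refl ι) α
  have h := DFunLike.congr_fun (congrArg MonoidAlgebra.coeff hv) (γ.trans α.symm)
  rw [lengthSeries, Finset.sum_mul] at h
  simp only [MonoidAlgebra.coeff_sum, Finsupp.coe_finsetSum, Finset.sum_apply,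
    MonoidAlgebra.coeff_single_mul_apply, MonoidAlgebra.one_def, MonoidAlgebra.coeff_single,
    Finsupp.single_apply] at h
  rw [Matrix.mul_apply, ← Equiv.sum_comp e, Matrix.one_apply]
  refine (Finset.sum_congr rfl fun g _ => ?_).trans (h.trans ?_)
  · have h1 : α.trans (e g).symm = g⁻¹ := by ext; simp [e]
    have h2 : γ.trans (e g).symm = g⁻¹ * (γ.trans α.symm) := by ext; simp [e]
    rw [lengthMatrix, Matrix.of_apply, Matrix.of_apply, h1, h2, permLength, cycleCount_inv,
      ← permLength]
  · refine if_congr ⟨fun h => ?_, ?_⟩ rfl rfl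
    · ext a
      have := congrArg α (DFunLike.congr_fun h a)
      simpa using this
    · rintro rfl
      ext; simp

end JucysMurphy

/-! ### Invariants of the unitary group in tensor powers -/

section Commutant

variable {ι N : Type*} [Fintype ι] [DecidableEq ι] [Fintype N] [DecidableEq N]

/-- The entries of the tensor power `V ⊗ ⋯ ⊗ V`. -/
def tensorEntry (V : Matrix N N ℂ) (i a : ι → N) : ℂ := ∏ k, V (i k) (a k)

/-- A matrix with multi-indices commutes with the tensor powers of all unitary matrices. -/
def CommutesWithUnitary (T : (ι → N) → (ι → N) → ℂ) : Prop :=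
  ∀ V ∈ Matrix.unitaryGroup N ℂ, ∀ i i', ∑ a, tensorEntry V i a * T a i' =
    ∑ a, T i a * tensorEntry V a i'

variable {T : (ι → N) → (ι → N) → ℂ}

omit [DecidableEq ι] [Fintype N] [DecidableEq N] in
theorem tensorEntry_comp (V : Matrix N N ℂ) (i a : ι → N) (σ : Equiv.Perm ι) :
    tensorEntry V (i ∘ σ) (a ∘ σ) = tensorEntry V i a :=
  Equiv.prod_comp σ fun k => V (i k) (a k)

/-- Diagonal unitaries detect weights: a nonzero entry forces both multi-indices to take each value
equally often. -/
theorem CommutesWithUnitary.exists_perm (hT : CommutesWithUnitary T) {i i' : ι → N}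
    (h : T i i' ≠ 0) : ∃ σ : Equiv.Perm ι, i = i' ∘ σ := by
  have key (b : N) : Fintype.card {k // i k = b} = Fintype.card {k // i' k = b} := by
    -- Multiplicities range over $0,\dots,|\iota|$, so a root of unity of order $|\iota|+1$ has
    -- distinct powers at distinct multiplicities.
    have hζ := Complex.isPrimitiveRoot_exp (Fintype.card ι + 1) (by omega)
    set ζ := Complex.exp (2 * Real.pi * Complex.I / (Fintype.card ι + 1 : ℕ))
    set d : N → ℂ := fun c => if c = b then ζ else 1
    have hV : Matrix.diagonal d ∈ Matrix.unitaryGroup N ℂ := by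
      rw [Matrix.mem_unitaryGroup_iff, Matrix.star_eq_conjTranspose,
        Matrix.diagonal_conjTranspose, Matrix.diagonal_mul_diagonal, ← Matrix.diagonal_one]
      congr 1
      ext c
      by_cases hc : c = b
      · simp [d, hc, Complex.mul_conj, Complex.normSq_eq_norm_sq,
          hζ.norm'_eq_one (by omega)]
      · simp [d, hc]
    have hent (i a : ι → N) : tensorEntry (Matrix.diagonal d) i a =
        if i = a then ζ ^ Fintype.card {k // i k = b} else 0 := by
      split_ifs with hia
      · subst hia
        simp [tensorEntry, d, Finset.prod_ite, Fintype.card_subtype]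
      · obtain ⟨k, hk⟩ := Function.ne_iff.1 hia
        exact Finset.prod_eq_zero (Finset.mem_univ k) (Matrix.diagonal_apply_ne _ hk)
    have h1 := hT _ hV i i'
    simp only [hent, ite_mul, zero_mul, mul_ite, mul_zero, Finset.sum_ite_eq,
      Finset.sum_ite_eq', Finset.mem_univ, if_true] at h1
    rw [mul_comm] at h1
    exact hζ.pow_inj (Nat.lt_succ_of_le (Fintype.card_subtype_le _))
      (Nat.lt_succ_of_le (Fintype.card_subtype_le _)) (mul_left_cancel₀ h h1)
  refine ⟨Equiv.ofFiberEquiv (f := i) (g := i') fun b => Fintype.equivOfCardEq (key b), ?_⟩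
  ext k
  exact (Equiv.ofFiberEquiv_map _ k).symm

theorem CommutesWithUnitary.apply_perm (hT : CommutesWithUnitary T) (g : Equiv.Perm N)
    (i i' : ι → N) : T (g ∘ i) (g ∘ i') = T i i' := by
  let V : Matrix N N ℂ := Matrix.of fun p q => if p = g q then 1 else 0
  have hV : V ∈ Matrix.unitaryGroup N ℂ := by
    rw [Matrix.mem_unitaryGroup_iff]
    ext p q
    rw [Matrix.mul_apply, ← Equiv.sum_comp g.symm]
    simp [V, Matrix.star_apply, Matrix.one_apply, apply_ite, eq_comm]
  have hent (i a : ι → N) : tensorEntry V i a = if i = g ∘ a then 1 else 0 := by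
    split_ifs with hia
    · subst hia
      simp [tensorEntry, V]
    · obtain ⟨k, hk⟩ := Function.ne_iff.1 hia
      exact Finset.prod_eq_zero (Finset.mem_univ k) (if_neg hk)
  have h1 := hT V hV (g ∘ i) i'
  have h2 (a : ι → N) : g ∘ i = g ∘ a ↔ i = a := g.injective.comp_left.eq_iff
  simp only [hent, h2] at h1
  simpa using h1.symm

/-- Outside row `b`, the support of `V` is the graph of the map that merges `b` into `a`. The
reflection in a unit vector supported on `a` and `b` does this. -/
theorem exists_unitary_collapse {a b : N} (hab : a ≠ b) :
    ∃ V ∈ Matrix.unitaryGroup N ℂ, ∀ p q, p ≠ b → (V p q ≠ 0 ↔ p = if q = b then a else q) := by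
  -- With these values row `a` of the reflection has entries $7/25$ and $-24/25$ at `a` and `b`,
  -- both nonzero.
  let v : N → ℂ := fun p => if p = a then 3 / 5 else if p = b then 4 / 5 else 0
  have hv : v ⬝ᵥ v = 1 := by
    have : ∀ p, v p * v p = (if p = a then 9 / 25 else 0) + if p = b then 16 / 25 else 0 := by
      intro p
      by_cases h1 : p = a
      · simp [v, h1, hab]; norm_num
      · by_cases h2 : p = b
        · simp [v, h2, hab.symm]; norm_num
        · simp [v, h1, h2]
    simp only [dotProduct, this, Finset.sum_add_distrib, Finset.sum_ite_eq', Finset.mem_univ,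
      if_true]
    norm_num
  have hstar : star v = v := by
    ext p
    simp only [Pi.star_apply, v]
    split_ifs <;> simp
  refine ⟨1 - (2 : ℂ) • Matrix.vecMulVec v v, ?_, fun p q hp => ?_⟩
  · have hs : star (Matrix.vecMulVec v v) = Matrix.vecMulVec v v := by
      rw [Matrix.star_eq_conjTranspose, Matrix.conjTranspose_vecMulVec, hstar]
    have hm : Matrix.vecMulVec v v * Matrix.vecMulVec v v = Matrix.vecMulVec v v := by
      rw [Matrix.vecMulVec_mul_vecMulVec, hv, one_smul]
    rw [Matrix.mem_unitaryGroup_iff, star_sub, star_smul, hs, star_one]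
    simp only [sub_mul, mul_sub, one_mul, mul_one, smul_mul_assoc, mul_smul_comm, hm]
    have h2 : star (2 : ℂ) = 2 := star_ofNat 2
    rw [h2]
    module
  · simp only [Matrix.sub_apply, Matrix.smul_apply, Matrix.vecMulVec_apply, Matrix.one_apply,
      smul_eq_mul]
    by_cases hpa : p = a
    · by_cases hqb : q = b
      · subst hpa hqb; simp [v, hab, hab.symm]
      · by_cases hqa : q = a
        · subst hpa hqa; simp [v, hab]; norm_num
        · simp [v, hqb, hqa, hpa, Ne.symm hqa]
    · by_cases hqb : q = b
      · simp [v, hpa, hp, hqb]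
      · simp [v, hpa, hp, hqb]

/-- The expansion passes, with the same coefficients, from `i'` to its image under the merging map.
For `i` avoiding `b`, commutation with the collapsing unitary leaves on each side only terms
carrying the common nonzero factor `u`; for `i` meeting `b`, both sides vanish by weights. -/
theorem CommutesWithUnitary.collapse (hT : CommutesWithUnitary T) {c : Equiv.Perm ι → ℂ}
    {i' : ι → N} (h : ∀ i, T i i' = ∑ σ : Equiv.Perm ι, if i = i' ∘ σ then c σ else 0)
    {a b : N} (hab : a ≠ b) (i : ι → N) :
    T i ((fun q => if q = b then a else q) ∘ i') = ∑ σ : Equiv.Perm ι,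
      if i = (fun q => if q = b then a else q) ∘ i' ∘ σ then c σ else 0 := by
  obtain ⟨V, hV, hVφ⟩ := exists_unitary_collapse hab
  set φ : N → N := fun q => if q = b then a else q
  have hφ (q : N) : φ q ≠ b := by
    by_cases hq : q = b <;> simp [φ, hq, hab]
  by_cases hi : ∃ k, i k = b
  · obtain ⟨k, hk⟩ := hi
    have hne (σ : Equiv.Perm ι) : i ≠ φ ∘ i' ∘ σ := fun he => hφ _ ((congrFun he k).symm.trans hk)
    rw [Finset.sum_eq_zero fun σ _ => if_neg (hne σ)]
    by_contra h0
    obtain ⟨σ, hσ⟩ := hT.exists_perm h0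
    exact hne σ hσ
  · push Not at hi
    have hent (i x : ι → N) (hi : ∀ k, i k ≠ b) : tensorEntry V i x ≠ 0 ↔ i = φ ∘ x := by
      rw [tensorEntry, Finset.prod_ne_zero_iff, funext_iff]
      exact forall_congr' fun k => by simpa using hVφ (i k) (x k) (hi k)
    set u := tensorEntry V (φ ∘ i') i' with hu
    have hu0 : u ≠ 0 := (hent _ _ fun k => hφ _).2 rfl
    have h1 := hT V hV i i'
    -- A nonzero `T i x` makes `x` a rearrangement of `i`, so `x` avoids `b` too and the support of
    -- `V` forces `x = φ ∘ i'`.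
    have hR : ∑ x, T i x * tensorEntry V x i' = T i (φ ∘ i') * u := by
      refine Finset.sum_eq_single_of_mem _ (Finset.mem_univ _) fun x _ hx => ?_
      by_contra h0
      obtain ⟨σ, hσ⟩ := hT.exists_perm (left_ne_zero_of_mul h0)
      refine hx ((hent x i' fun k hk => hi (σ.symm k) ?_).1 (right_ne_zero_of_mul h0))
      simp [hσ, hk]
    have hL : ∑ x, tensorEntry V i x * T x i' =
        (∑ σ : Equiv.Perm ι, if i = φ ∘ i' ∘ σ then c σ else 0) * u := by
      simp only [h, Finset.mul_sum, Finset.sum_mul]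
      rw [Finset.sum_comm]
      refine Finset.sum_congr rfl fun σ _ => ?_
      simp only [mul_ite, mul_zero, Finset.sum_ite_eq', Finset.mem_univ, if_true, ite_mul,
        zero_mul]
      split_ifs with hiσ
      · rw [hiσ, hu, ← tensorEntry_comp V (φ ∘ i') i' σ, mul_comm]
        rfl
      · rw [not_not.1 (mt (hent i (i' ∘ σ) hi).1 hiσ), zero_mul]
    rw [hL, hR] at h1
    exact (mul_right_cancel₀ hu0 h1).symm

/-- The coefficients are read off at one injective multi-index, where distinct permutations give
distinct rearrangements. Permutation matrices carry the formula to all injective multi-indices, and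
merging values carries it to the others. -/
theorem CommutesWithUnitary.exists_eq_sum (hT : CommutesWithUnitary T)
    (hcard : Fintype.card ι ≤ Fintype.card N) :
    ∃ c : Equiv.Perm ι → ℂ,
      ∀ i i', T i i' = ∑ σ : Equiv.Perm ι, if i = i' ∘ σ then c σ else 0 := by
  obtain ⟨i₀⟩ := Function.Embedding.nonempty_of_card_le hcard
  have h0 (i : ι → N) : T i i₀ = ∑ σ : Equiv.Perm ι, if i = i₀ ∘ σ then T (i₀ ∘ σ) i₀ else 0 := by
    by_cases h : T i i₀ = 0
    · rw [h, eq_comm]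
      refine Finset.sum_eq_zero fun σ _ => ?_
      split_ifs with hi
      · rw [← hi, h]
      · rfl
    · obtain ⟨σ, rfl⟩ := hT.exists_perm h
      rw [Finset.sum_eq_single_of_mem σ (Finset.mem_univ _), if_pos rfl]
      intro τ _ hτ
      refine if_neg fun he => hτ (Equiv.ext fun k => ?_)
      exact (i₀.injective (congrFun he k)).symm
  refine ⟨fun σ => T (i₀ ∘ σ) i₀, fun i i' => ?_⟩
  -- Induction on the number of values lost: a non-injective `i'` arises by merging from a
  -- multi-index with one more value, obtained by moving one of two coinciding entries to an unused
  -- value `b`.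
  induction hm : Fintype.card ι - (Finset.univ.image i').card generalizing i i' with
  | zero =>
    have hinj : Function.Injective i' := by
      rw [← Finset.card_univ, Nat.sub_eq_zero_iff_le] at hm
      simpa using Finset.card_image_iff.1 (le_antisymm Finset.card_image_le hm)
    obtain ⟨g, hg⟩ := Finset.exists_equiv_extend_of_card_eq (t := (Finset.univ : Finset N))
      (s := Finset.univ.image i₀) (f := Function.extend i₀ i' id) rfl (Finset.subset_univ _) (by
        intro x hx y hy hxy
        obtain ⟨k, -, rfl⟩ := Finset.mem_image.1 (Finset.mem_coe.1 hx)
        obtain ⟨l, -, rfl⟩ := Finset.mem_image.1 (Finset.mem_coe.1 hy)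
        rw [i₀.injective.extend_apply, i₀.injective.extend_apply] at hxy
        rw [hinj hxy])
    let g' : Equiv.Perm N := g.trans (Equiv.subtypeUnivEquiv Finset.mem_univ)
    have hg' : g' ∘ i₀ = i' := by
      ext k
      exact (hg (i₀ k) (Finset.mem_image_of_mem _ (Finset.mem_univ k))).trans
        (i₀.injective.extend_apply _ _ _)
    have hi : i = g' ∘ (g'.symm ∘ i) := by ext; simp
    rw [← hg', hi, hT.apply_perm, h0]
    refine Finset.sum_congr rfl fun σ _ => if_congr ?_ rfl rfl
    exact g'.injective.comp_left.eq_iff.symm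
  | succ m ih =>
    have hninj : ¬ Function.Injective i' := fun h => by
      rw [Finset.card_image_of_injective _ h, Finset.card_univ, Nat.sub_self] at hm
      omega
    obtain ⟨k, l, hkl, hne⟩ := Function.not_injective_iff.1 hninj
    obtain ⟨b, hb⟩ : ∃ b, b ∉ Finset.univ.image i' := by
      by_contra hall
      push Not at hall
      rw [Finset.eq_univ_iff_forall.2 hall, Finset.card_univ] at hm
      omega
    have hb' (x : ι) : i' x ≠ b := fun hx =>
      hb (hx ▸ Finset.mem_image_of_mem _ (Finset.mem_univ x))
    have hins : Finset.univ.image (Function.update i' k b) =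
        insert b (Finset.univ.image i') := by
      refine Finset.Subset.antisymm (fun x hx => ?_) fun x hx => ?_
      · obtain ⟨y, -, rfl⟩ := Finset.mem_image.1 hx
        by_cases hy : y = k <;> simp [hy]
      · rcases Finset.mem_insert.1 hx with rfl | hx
        · exact Finset.mem_image.2 ⟨k, Finset.mem_univ _, by simp⟩
        · obtain ⟨y, -, rfl⟩ := Finset.mem_image.1 hx
          by_cases hy : y = k
          · exact Finset.mem_image.2 ⟨l, Finset.mem_univ _, by simp [hne.symm, ← hkl, hy]⟩
          · exact Finset.mem_image.2 ⟨y, Finset.mem_univ _, by simp [hy]⟩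
    have hupd : (fun q => if q = b then i' k else q) ∘ Function.update i' k b = i' := by
      ext x
      by_cases hx : x = k
      · simp [hx]
      · simp [hx, hb' x]
    have h2 := hT.collapse (fun j => ih j (Function.update i' k b) (by
      rw [hins, Finset.card_insert_of_notMem hb]
      omega)) (hb' k) i
    simp only [← Function.comp_assoc, hupd] at h2
    exact h2

end Commutant

/-! ### Moments of a Haar unitary matrix -/

section Moments

instance instIsMulLeftInvariantHaarU (n : ℕ) : (haarU n).IsMulLeftInvariant := by
  unfold haarU
  infer_instance

theorem integrable_haarU {n : ℕ} {f : U n → ℂ} (hf : Continuous f) : Integrable f (haarU n) :=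
  hf.integrable_of_hasCompactSupport (HasCompactSupport.of_compactSpace f)

variable {n : ℕ} {ι ι' : Type*} [Fintype ι] [Fintype ι']

theorem continuous_entry (a b : Fin n) : Continuous fun A : U n => A.1 a b :=
  continuous_subtype_val.matrix_elem a b

theorem continuous_prod_entry (i j : ι → Fin n) :
    Continuous fun A : U n => ∏ k, A.1 (i k) (j k) :=
  continuous_finsetProd _ fun _ _ => continuous_entry _ _

theorem continuous_prod_star_entry (i j : ι → Fin n) :
    Continuous fun A : U n => ∏ k, star (A.1 (i k) (j k)) :=
  continuous_finsetProd _ fun _ _ => (continuous_entry _ _).star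

theorem continuous_moment (i j : ι → Fin n) (i' j' : ι' → Fin n) :
    Continuous fun A : U n => (∏ k, A.1 (i k) (j k)) * ∏ k, star (A.1 (i' k) (j' k)) :=
  (continuous_prod_entry i j).mul (continuous_prod_star_entry i' j')

/-- The mixed moments of the entries of a Haar unitary matrix. -/
noncomputable def haarMoment (i j : ι → Fin n) (i' j' : ι' → Fin n) : ℂ :=
  ∫ A : U n, (∏ k, A.1 (i k) (j k)) * ∏ k, star (A.1 (i' k) (j' k)) ∂haarU n

theorem commutesWithUnitary_haarMoment [DecidableEq ι] (j j' : ι → Fin n) :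
    CommutesWithUnitary fun i i' : ι → Fin n => haarMoment i j i' j' := by
  intro V hV i i'
  set V' : U n := ⟨V, hV⟩ with hV'
  have hmul (A : U n) (i j : ι → Fin n) : ∏ k, (V' * A).1 (i k) (j k) =
      ∑ a : ι → Fin n, tensorEntry V i a * ∏ k, A.1 (a k) (j k) := by
    simp only [hV', Submonoid.coe_mul, Matrix.mul_apply, Finset.prod_univ_sum,
      Fintype.piFinset_univ, tensorEntry, Finset.prod_mul_distrib]
  have hstar (A : U n) (i j : ι → Fin n) : ∏ k, star ((V'⁻¹ * A).1 (i k) (j k)) =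
      ∑ a : ι → Fin n, tensorEntry V a i * ∏ k, star (A.1 (a k) (j k)) := by
    have hinv : (V'⁻¹ : U n).1 = star V := rfl
    simp only [Submonoid.coe_mul, hinv, Matrix.mul_apply, star_sum, star_mul', Matrix.star_apply,
      star_star, Finset.prod_univ_sum, Fintype.piFinset_univ, tensorEntry,
      Finset.prod_mul_distrib]
  -- Placing `V'⁻¹` in the conjugated factor makes the substitution $A\mapsto V'A$ carry the unitary
  -- from one factor to the other; conjugating the entries of $V'^{-1}$ gives those of $V'$
  -- transposed.
  have hleft := integral_mul_left_eq_self (μ := haarU n)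
    (fun A : U n => (∏ k, A.1 (i k) (j k)) * ∏ k, star ((V'⁻¹ * A).1 (i' k) (j' k))) V'
  simp only [inv_mul_cancel_left, hmul, hstar, Finset.sum_mul, Finset.mul_sum] at hleft
  rw [integral_finsetSum _ fun a _ => ?_, integral_finsetSum _ fun a _ => ?_] at hleft
  · refine Eq.trans (Finset.sum_congr rfl fun a _ => ?_)
      (hleft.trans (Finset.sum_congr rfl fun a _ => ?_))
    · simp only [haarMoment, ← integral_const_mul, mul_assoc]
    · simp only [haarMoment, ← integral_mul_const]
      refine integral_congr_ae (Filter.Eventually.of_forall fun A => ?_)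
      ring
  · refine integrable_haarU ?_
    exact (continuous_prod_entry i j).mul
      (continuous_const.mul (continuous_prod_star_entry a j'))
  · refine integrable_haarU ?_
    exact (continuous_const.mul (continuous_prod_entry a j)).mul
      (continuous_prod_star_entry i' j')

/-- The columns of a unitary matrix are orthonormal, so the contracted integrand is already
constant. -/
theorem sum_haarMoment [DecidableEq ι'] (β : ι ≃ ι') (j : ι → Fin n) (j' : ι' → Fin n) :
    ∑ i' : ι' → Fin n, haarMoment (i' ∘ β) j i' j' = if j = j' ∘ β then 1 else 0 := by
  have hA (A : U n) : ∑ i' : ι' → Fin n, (∏ k, A.1 ((i' ∘ β) k) (j k)) *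
      ∏ k, star (A.1 (i' k) (j' k)) = if j = j' ∘ β then 1 else 0 := by
    have h1 (i' : ι' → Fin n) : ∏ k, A.1 ((i' ∘ β) k) (j k) =
        ∏ k, A.1 (i' k) (j (β.symm k)) := by
      rw [← Equiv.prod_comp β]
      simp
    have h2 (a b : Fin n) : ∑ c, A.1 c a * star (A.1 c b) = if a = b then 1 else 0 := by
      have := congrFun (congrFun (Matrix.mem_unitaryGroup_iff'.1 A.2) b) a
      rw [Matrix.mul_apply, Matrix.one_apply] at this
      refine (Finset.sum_congr rfl fun c _ => mul_comm _ _).trans (this.trans ?_)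
      exact if_congr eq_comm rfl rfl
    simp only [h1, ← Finset.prod_mul_distrib]
    have h3 := Finset.prod_univ_sum (fun _ : ι' => (Finset.univ : Finset (Fin n)))
      fun k c => A.1 c (j (β.symm k)) * star (A.1 c (j' k))
    rw [Fintype.piFinset_univ] at h3
    rw [← h3]
    simp only [h2]
    split_ifs with hj
    · subst hj; simp
    · obtain ⟨k, hk⟩ := Function.ne_iff.1 hj
      exact Finset.prod_eq_zero (Finset.mem_univ (β k)) (if_neg (by simpa using hk))
  have h4 : ∫ A : U n, ∑ i' : ι' → Fin n, (∏ k, A.1 ((i' ∘ β) k) (j k)) *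
      ∏ k, star (A.1 (i' k) (j' k)) ∂haarU n = if j = j' ∘ β then 1 else 0 := by
    simp only [hA, integral_const, probReal_univ, one_smul]
  rwa [integral_finsetSum _ fun i' _ => integrable_haarU (continuous_moment _ _ _ _)] at h4

/-- The moments of a Haar unitary matrix in terms of the Weingarten matrix. -/
theorem haarMoment_eq [DecidableEq ι] [DecidableEq ι'] (e : ι ≃ ι') (hn : 0 < n)
    (hcard : Fintype.card ι ≤ n)
    {W : Matrix (ι ≃ ι') (ι ≃ ι') (summableSeries (n : ℂ)⁻¹)}
    (hW : lengthMatrix (n : ℂ)⁻¹ ι ι' * W = 1) (i j : ι → Fin n) (i' j' : ι' → Fin n) :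
    haarMoment i j i' j' = ∑ α : ι ≃ ι', ∑ β : ι ≃ ι',
      if i = i' ∘ α ∧ j = j' ∘ β then
        ((n : ℂ) ^ Fintype.card ι)⁻¹ * evalSeries (n : ℂ)⁻¹ (W α β) else 0 := by
  have hn0 : (n : ℂ) ≠ 0 := Nat.cast_ne_zero.2 hn.ne'
  obtain ⟨c, hc⟩ := (commutesWithUnitary_haarMoment j (j' ∘ e)).exists_eq_sum
    (hcard.trans_eq (Fintype.card_fin n).symm)
  let q : Equiv.Perm ι ≃ (ι ≃ ι') := Equiv.equivCongr (Equiv.refl ι) e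
  have hmom (i : ι → Fin n) (f : ι' → Fin n) : haarMoment i j f j' =
      ∑ α : ι ≃ ι', if i = f ∘ α then c (q.symm α) else 0 := by
    have h1 : haarMoment i j f j' = haarMoment i j (f ∘ e) (j' ∘ e) := by
      simp only [haarMoment]
      congr 1
      ext A
      rw [← Equiv.prod_comp e fun k => star (A.1 (f k) (j' k))]
      rfl
    rw [h1, ← Equiv.sum_comp q]
    refine (hc i (f ∘ e)).trans (Finset.sum_congr rfl fun σ _ => ?_)
    rw [Equiv.symm_apply_apply]
    rfl
  -- Contracting the expansion along `β` gives a linear system for the coefficients: the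
  -- multi-indices compatible with both `α` and `β` number $n$ to the cycles, which is
  -- $n^{|\iota|}(1/n)^{\text{length}}$.
  have hcon (β : ι ≃ ι') : (if j = j' ∘ β then 1 else 0) = (n : ℂ) ^ Fintype.card ι *
      ∑ α, evalSeries (n : ℂ)⁻¹ (lengthMatrix _ ι ι' β α) * c (q.symm α) := by
    rw [← sum_haarMoment β j j', Finset.mul_sum]
    simp only [hmom]
    rw [Finset.sum_comm]
    refine Finset.sum_congr rfl fun α _ => ?_
    have hcount : (Finset.univ.filter fun f : ι' → Fin n => f ∘ β = f ∘ α).card =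
        n ^ cycleCount (β.trans α.symm) := by
      rw [← Fintype.card_subtype, ← Nat.card_eq_fintype_card]
      refine (Nat.card_congr ((Equiv.arrowCongr α.symm (Equiv.refl _)).subtypeEquiv fun f => ?_)).trans
        ((card_invFun (β.trans α.symm) (Fin n)).trans (by simp))
      simp [funext_iff]
    rw [← Finset.sum_filter, Finset.sum_const, hcount, nsmul_eq_mul, ← mul_assoc, lengthMatrix,
      Matrix.of_apply, map_pow, evalSeries_X, inv_pow]
    have hlen := permLength_add_cycleCount (β.trans α.symm : Equiv.Perm ι)
    rw [Nat.card_eq_fintype_card] at hlen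
    rw [← hlen, pow_add]
    field_simp
    push_cast
    ring
  have hcoef (α : ι ≃ ι') : c (q.symm α) = ∑ β : ι ≃ ι', if j = j' ∘ β then
      ((n : ℂ) ^ Fintype.card ι)⁻¹ * evalSeries (n : ℂ)⁻¹ (W α β) else 0 := by
    have h1 (β : ι ≃ ι') : (if j = j' ∘ β then
        ((n : ℂ) ^ Fintype.card ι)⁻¹ * evalSeries (n : ℂ)⁻¹ (W α β) else 0) =
        ∑ γ, evalSeries (n : ℂ)⁻¹ (W α β * lengthMatrix _ ι ι' β γ) * c (q.symm γ) := by
      have := hcon β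
      rw [← mul_one (_ * _), ← mul_ite_zero, this]
      simp only [map_mul, mul_assoc, ← Finset.mul_sum]
      field_simp
    simp only [h1]
    rw [Finset.sum_comm]
    simp only [← Finset.sum_mul, ← map_sum, ← Matrix.mul_apply, mul_eq_one_comm.1 hW,
      Matrix.one_apply]
    simp [apply_ite]
  rw [hmom]
  refine Finset.sum_congr rfl fun α _ => ?_
  rw [hcoef]
  simp only [ite_and, Finset.sum_ite_irrel, Finset.sum_const_zero]

end Moments

/-! ### Products and traces of matrices as sums over index functions -/

section PathSums

variable {N R : Type*} [Fintype N] [DecidableEq N] [CommRing R]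

theorem list_ofFn_prod_apply {m : ℕ} (M : Fin m → Matrix N N R) (a b : N) :
    (List.ofFn M).prod a b = ∑ f : Fin (m + 1) → N,
      if f 0 = a ∧ f (Fin.last m) = b then ∏ k : Fin m, M k (f k.castSucc) (f k.succ) else 0 := by
  induction m generalizing a with
  | zero =>
    rw [← Equiv.sum_comp (Equiv.funUnique (Fin 1) N).symm]
    simp [Matrix.one_apply, ite_and]
  | succ m ih =>
    rw [← Equiv.sum_comp (Fin.consEquiv fun _ => N), Fintype.sum_prod_type]
    simp only [List.ofFn_succ, List.prod_cons, Matrix.mul_apply, ih, Fin.consEquiv_apply,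
      Fin.cons_zero, Fin.prod_univ_succ, Fin.castSucc_zero, Fin.cons_succ, ← Fin.succ_last,
      ← Fin.succ_castSucc, ite_and, Finset.sum_ite_irrel, Finset.sum_const_zero]
    rw [Finset.sum_ite_eq' Finset.univ a, if_pos (Finset.mem_univ _)]
    simp only [Finset.mul_sum]
    rw [Finset.sum_comm]
    refine Finset.sum_congr rfl fun f _ => ?_
    simp

/-- Closing the index path makes its last value redundant. For `m = 0` the left side is the size of
`N` and the right side is `1`, which is why nontrivial words are needed. -/
theorem trace_list_ofFn_prod {m : ℕ} (hm : m ≠ 0) (M : Fin m → Matrix N N R) :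
    (List.ofFn M).prod.trace = ∑ f : Fin m → N, ∏ k, M k (f k) (f (finRotate m k)) := by
  obtain ⟨m, rfl⟩ := Nat.exists_eq_succ_of_ne_zero hm
  simp only [Matrix.trace, Matrix.diag, list_ofFn_prod_apply]
  rw [Finset.sum_comm, ← Equiv.sum_comp (Fin.snocEquiv fun _ => N), Fintype.sum_prod_type,
    Finset.sum_comm]
  refine Finset.sum_congr rfl fun g _ => ?_
  have h0 (y : N) : Fin.snoc (α := fun _ => N) g y 0 = g 0 := by
    rw [← Fin.castSucc_zero, Fin.snoc_castSucc]
  simp only [Fin.snocEquiv_apply, h0, Fin.snoc_last, Fin.snoc_castSucc, ite_and]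
  simp only [Finset.sum_ite_eq, Finset.mem_univ, if_true]
  rw [Finset.sum_ite_eq' Finset.univ (g 0), if_pos (Finset.mem_univ _)]
  refine Finset.prod_congr rfl fun k _ => ?_
  congr 1
  cases k using Fin.lastCases with
  | last => simp
  | cast k =>
    rw [Fin.succ_castSucc, Fin.snoc_castSucc, finRotate_apply, Fin.coeSucc_eq_succ]

end PathSums

/-! ### The expected product of traces as a sum over pairs of matchings -/

section ExpTrace

variable {r ℓ : ℕ} {w : Fin ℓ → FreeGroup (Fin r)}

/-- The letters, sorted by generator and sign. -/
noncomputable def letterEquiv (w : Fin ℓ → FreeGroup (Fin r)) :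
    (Σ x : Fin r, PosLetter w x ⊕ NegLetter w x) ≃ Letter w :=
  Equiv.ofBijective (fun z => z.2.elim Subtype.val Subtype.val) (by
    constructor
    · rintro ⟨x, ⟨p, hp⟩ | ⟨p, hp⟩⟩ ⟨y, ⟨q, hq⟩ | ⟨q, hq⟩⟩ h <;> obtain rfl : p = q := h <;>
        obtain ⟨rfl, hb⟩ := Prod.mk.inj (hp.symm.trans hq) <;>
        first | rfl | exact absurd hb (by decide)
    · intro p
      rcases letter_cases p with ⟨x, q, rfl⟩ | ⟨x, q, rfl⟩
      · exact ⟨⟨x, Sum.inl q⟩, rfl⟩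
      · exact ⟨⟨x, Sum.inr q⟩, rfl⟩)

/-- The pairing of letters given by `α` on the letters `x⁺¹` and by the inverse of `β` on the
letters `x⁻¹`. -/
noncomputable def letterPairing (α β : (x : Fin r) → Matching w x) : Equiv.Perm (Letter w) :=
  (letterEquiv w).permCongr (Equiv.sigmaCongrRight fun x =>
    (Equiv.sumCongr (α x) (β x).symm).trans (Equiv.sumComm _ _))

theorem letterPairing_pos (α β : (x : Fin r) → Matching w x) {x : Fin r} (p : PosLetter w x) :
    letterPairing α β p.1 = (α x p).1 := by
  have h : (letterEquiv w).symm p.1 = ⟨x, Sum.inl p⟩ := (letterEquiv w).symm_apply_eq.2 rfl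
  rw [letterPairing, Equiv.permCongr_apply, h]
  rfl

theorem letterPairing_neg (α β : (x : Fin r) → Matching w x) {x : Fin r} (q : NegLetter w x) :
    letterPairing α β q.1 = ((β x).symm q).1 := by
  have h : (letterEquiv w).symm q.1 = ⟨x, Sum.inr q⟩ := (letterEquiv w).symm_apply_eq.2 rfl
  rw [letterPairing, Equiv.permCongr_apply, h]
  rfl

/-- The permutation of the letters, i.e. of the `o`-points, whose cycles are the discs with
`o`-points on their boundary. -/
noncomputable def outerPerm (α β : (x : Fin r) → Matching w x) : Equiv.Perm (Letter w) :=
  (letterPairing α β).trans (nextLetter w)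

theorem outerPerm_pos (α β : (x : Fin r) → Matching w x) {x : Fin r} (p : PosLetter w x) :
    outerPerm α β p.1 = nextLetter w (α x p).1 := by
  rw [outerPerm, Equiv.trans_apply, letterPairing_pos]

theorem outerPerm_neg (α β : (x : Fin r) → Matching w x) {x : Fin r} (q : NegLetter w x) :
    outerPerm α β q.1 = nextLetter w ((β x).symm q).1 := by
  rw [outerPerm, Equiv.trans_apply, letterPairing_neg]

/-- The matrix of a letter. -/
def letterMatrix {n : ℕ} (A : Fin r → U n) (v : Fin r × Bool) : Matrix (Fin n) (Fin n) ℂ :=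
  if v.2 then (A v.1).1 else star (A v.1).1

theorem evalWord_eq {n : ℕ} (A : Fin r → U n) (v : FreeGroup (Fin r)) :
    (evalWord A v).1 = (List.ofFn fun k => letterMatrix A (v.toWord.get k)).prod := by
  have h : evalWord A v = (v.toWord.map fun x => bif x.2 then A x.1 else (A x.1)⁻¹).prod := by
    conv_lhs => rw [evalWord, ← FreeGroup.mk_toWord (x := v)]
    rw [FreeGroup.lift_mk]
  have h2 : (evalWord A v).1 = (v.toWord.map (letterMatrix A)).prod := by
    rw [h]
    refine (map_list_prod (Submonoid.subtype (Matrix.unitaryGroup (Fin n) ℂ)) _).trans ?_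
    rw [List.map_map]
    congr 2
    ext1 ⟨x, b⟩
    cases b <;> rfl
  have h3 : (List.ofFn fun k => letterMatrix A (v.toWord.get k)) =
      (List.ofFn v.toWord.get).map (letterMatrix A) := by
    rw [List.map_ofFn]
    rfl
  rw [h2, h3, List.ofFn_get]

theorem prod_trace_eq {n : ℕ} (hw : ∀ i, w i ≠ 1) (A : Fin r → U n) :
    ∏ i, (evalWord A (w i)).1.trace = ∑ F : Letter w → Fin n,
      ∏ p, letterMatrix A (letterVal w p) (F p) (F (nextLetter w p)) := by
  have hlen (i : Fin ℓ) : (w i).toWord.length ≠ 0 := by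
    simpa [FreeGroup.toWord_eq_nil_iff] using hw i
  simp only [evalWord_eq, trace_list_ofFn_prod (hlen _)]
  rw [Finset.prod_univ_sum, Fintype.piFinset_univ,
    ← Equiv.sum_comp (Equiv.piCurry fun _ _ => Fin n)]
  refine Finset.sum_congr rfl fun F _ => ?_
  rw [Fintype.prod_sigma]
  rfl

/-- For a letter $x^{-1}$ the adjoint exchanges row and column, so the following `o`-point supplies
the row index. -/
theorem prod_letter_eq {n : ℕ} (A : Fin r → U n) (F : Letter w → Fin n) :
    ∏ p, letterMatrix A (letterVal w p) (F p) (F (nextLetter w p)) =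
      ∏ x, (∏ p : PosLetter w x, (A x).1 (F p.1) (F (nextLetter w p.1))) *
        ∏ q : NegLetter w x, star ((A x).1 (F (nextLetter w q.1)) (F q.1)) := by
  rw [← Fintype.prod_fiberwise (letterVal w), Fintype.prod_prod_type]
  refine Finset.prod_congr rfl fun x _ => ?_
  rw [Fintype.prod_bool]
  congr 1
  · refine Finset.prod_congr rfl fun p _ => ?_
    rw [p.2]
    rfl
  · refine Finset.prod_congr rfl fun p _ => ?_
    rw [p.2]
    rfl

theorem expTrace_eq_sum_haarMoment (hw : ∀ i, w i ≠ 1) (n : ℕ) :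
    expTrace w n = ∑ F : Letter w → Fin n, ∏ x,
      haarMoment (fun p : PosLetter w x => F p.1) (fun p => F (nextLetter w p.1))
        (fun q : NegLetter w x => F (nextLetter w q.1)) (fun q => F q.1) := by
  simp only [expTrace, prod_trace_eq hw, prod_letter_eq]
  rw [integral_finsetSum]
  · refine Finset.sum_congr rfl fun F _ => ?_
    exact integral_fintype_prod_eq_prod (𝕜 := ℂ) fun x (A : U n) =>
      (∏ p : PosLetter w x, A.1 (F p.1) (F (nextLetter w p.1))) *
        ∏ q : NegLetter w x, star (A.1 (F (nextLetter w q.1)) (F q.1))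
  · intro F _
    exact Integrable.fintype_prod (f := fun x (A : U n) =>
      (∏ p : PosLetter w x, A.1 (F p.1) (F (nextLetter w p.1))) *
        ∏ q : NegLetter w x, star (A.1 (F (nextLetter w q.1)) (F q.1)))
      fun x => integrable_haarU (continuous_moment _ _ _ _)

/-- The row conditions are invariance under `outerPerm` at the letters $x^{+1}$, and the column
conditions are invariance at the letters $x^{-1}$. -/
theorem card_outerPerm_invariant (n : ℕ) (α β : (x : Fin r) → Matching w x) :
    (Finset.univ.filter fun F : Letter w → Fin n => ∀ x,
      (fun p : PosLetter w x => F p.1) = (fun q : NegLetter w x => F (nextLetter w q.1)) ∘ α x ∧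
      (fun p : PosLetter w x => F (nextLetter w p.1)) =
        (fun q : NegLetter w x => F q.1) ∘ β x).card = n ^ cycleCount (outerPerm α β) := by
  rw [← Fintype.card_subtype, ← Nat.card_eq_fintype_card]
  refine (Nat.card_congr (Equiv.subtypeEquivRight fun F => ?_)).trans
    ((card_invFun (outerPerm α β) (Fin n)).trans (by simp))
  constructor
  · intro h p
    rcases letter_cases p with ⟨x, q, rfl⟩ | ⟨x, q, rfl⟩
    · rw [outerPerm_pos]
      exact (congrFun (h x).1 q).symm
    · rw [outerPerm_neg]
      simpa using congrFun (h x).2 ((β x).symm q)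
  · intro h x
    constructor
    · ext1 p
      have := h p.1
      rw [outerPerm_pos] at this
      exact this.symm
    · ext1 p
      have := h (β x p).1
      rw [outerPerm_neg, Equiv.symm_apply_apply] at this
      exact this

theorem expTrace_eq {n : ℕ} (hw : ∀ i, w i ≠ 1) (hbal : Balanced w) (hn : 0 < n)
    (hcard : ∀ x, letterCount w x ≤ n)
    (W : (x : Fin r) → Matrix (Matching w x) (Matching w x) (summableSeries (n : ℂ)⁻¹))
    (hW : ∀ x, lengthMatrix (n : ℂ)⁻¹ (PosLetter w x) (NegLetter w x) * W x = 1) :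
    expTrace w n = ∑ α : (x : Fin r) → Matching w x, ∑ β : (x : Fin r) → Matching w x,
      (n : ℂ) ^ cycleCount (outerPerm α β) *
        ∏ x, ((n : ℂ) ^ letterCount w x)⁻¹ * evalSeries (n : ℂ)⁻¹ (W x (α x) (β x)) := by
  rw [expTrace_eq_sum_haarMoment hw]
  simp only [fun x => haarMoment_eq (Fintype.equivOfCardEq (hbal x)) hn (hcard x) (hW x)]
  simp only [Finset.prod_univ_sum, Fintype.piFinset_univ, Finset.prod_ite_zero, Finset.mem_univ,
    true_implies]
  rw [Finset.sum_comm]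
  refine Finset.sum_congr rfl fun α _ => ?_
  rw [Finset.sum_comm]
  refine Finset.sum_congr rfl fun β _ => ?_
  rw [← Finset.sum_filter, Finset.sum_const, card_outerPerm_invariant, nsmul_eq_mul, Nat.cast_pow]
  rfl

end ExpTrace

/-! ### The Euler characteristic of the surface of a tuple of matchings -/

section EulerChar

variable {r ℓ : ℕ} {w : Fin ℓ → FreeGroup (Fin r)} {κ : Fin r → ℕ}

/-- The first matching for each generator. -/
def firstMatching (σ : MatchTuple w κ) (x : Fin r) : Matching w x := σ x 0

/-- The last matching for each generator. -/
def lastMatching (σ : MatchTuple w κ) (x : Fin r) : Matching w x := σ x (Fin.last _)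

/-- The permutation of the letters `x⁺¹` whose cycles are the discs between the `(x, j)`-points and
the `(x, j + 1)`-points. -/
def innerPerm (σ : MatchTuple w κ) (x : Fin r) (j : Fin (κ x)) : Equiv.Perm (PosLetter w x) :=
  (σ x j.succ).trans (σ x j.castSucc).symm

/-- The permutation of the directed edges whose cycles are the discs. -/
def dartPerm (σ : MatchTuple w κ) : Equiv.Perm (SurfaceDart w κ) := (surface σ).next

/-- The values at the arcs of a function which is constant along the discs. -/
def arcFun (σ : MatchTuple w κ) (F : Letter w → Bool)
    (G : (x : Fin r) → Fin (κ x) → PosLetter w x → Bool) : Point w κ → Bool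
  | Sum.inl p => F p
  | Sum.inr ⟨x, j, Sum.inl p⟩ =>
      Fin.lastCases (motive := fun _ => Bool) (F (nextLetter w p.1)) (fun i => G x i p) j
  | Sum.inr ⟨x, j, Sum.inr q⟩ =>
      Fin.cases (motive := fun _ => Bool) (F (nextLetter w q.1))
        (fun i => G x i ((σ x i.castSucc).symm q)) j

/-- Matching-edges can be skipped: the value on one equals the value on the arc after it, so the
arcs determine the function. -/
theorem invFun_next_arc {σ : MatchTuple w κ} (f : InvFun (dartPerm σ) Bool) (a : Point w κ) :
    f.1 (Sum.inl a) = Sum.elim (fun p => f.1 (Sum.inl (Sum.inl p)))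
      (fun z => f.1 (Sum.inl (Sum.inr (partner σ z)))) (succPoint a) := by
  have h := f.2 (Sum.inl a)
  change f.1 (Sum.elim _ _ _) = _ at h
  rw [← h]
  rcases succPoint a with p | z
  · rfl
  · exact (f.2 (Sum.inr z)).symm

/-- Functions on the set of discs: those with `o`-points on their boundary and the others. -/
noncomputable def faceFunEquiv (σ : MatchTuple w κ) : InvFun (dartPerm σ) Bool ≃
    InvFun (outerPerm (firstMatching σ) (lastMatching σ)) Bool ×
      ((x : Fin r) → (j : Fin (κ x)) → InvFun (innerPerm σ x j) Bool) where
  toFun f := by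
    refine ⟨⟨fun p => f.1 (Sum.inl (Sum.inl p)), fun p => ?_⟩, fun x j =>
      ⟨fun p => f.1 (Sum.inl (Sum.inr ⟨x, j.castSucc, Sum.inl p⟩)), fun p => ?_⟩⟩
    -- After an `o`-point the disc crosses the outermost matching-edge (index `0` for $x^{+1}$, `κ
    -- x` for $x^{-1}$), lands on the last `z`-point of the partner letter and runs into the next
    -- `o`-point.
    · rcases letter_cases p with ⟨x, q, rfl⟩ | ⟨x, q, rfl⟩
      · have h1 := invFun_next_arc f (Sum.inl q.1)
        have h2 := invFun_next_arc f (Sum.inr ⟨x, 0, Sum.inr (σ x 0 q)⟩)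
        simp only [succPoint, firstZ_pos, Sum.elim_inr, partner] at h1
        beta_reduce
        rw [h1, h2, outerPerm_pos]
        simp [succPoint, firstMatching]
      · have h1 := invFun_next_arc f (Sum.inl q.1)
        have h2 := invFun_next_arc f (Sum.inr ⟨x, Fin.last _, Sum.inl ((σ x (Fin.last _)).symm q)⟩)
        simp only [succPoint, firstZ_neg, Sum.elim_inr, partner] at h1
        beta_reduce
        rw [h1, h2, outerPerm_neg]
        simp [succPoint, lastMatching]
    -- The disc moves from `j` to `j + 1` on a letter $x^{+1}$, crosses, moves back from `j + 1` to
    -- `j` on a letter $x^{-1}$ and crosses again: one application of `innerPerm`.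
    · have h1 := invFun_next_arc f (Sum.inr ⟨x, j.castSucc, Sum.inl p⟩)
      have h2 := invFun_next_arc f (Sum.inr ⟨x, j.succ, Sum.inr (σ x j.succ p)⟩)
      simp only [succPoint, Fin.lastCases_castSucc, Fin.cases_succ, Sum.elim_inr, partner] at h1 h2
      beta_reduce
      rw [h1, h2]
      rfl
  invFun g := by
    refine ⟨Sum.elim (arcFun σ g.1.1 fun x j => (g.2 x j).1)
      fun z => arcFun σ g.1.1 (fun x j => (g.2 x j).1) (Sum.inr (partner σ z)), ?_⟩
    rintro (a | z)
    · change Sum.elim _ _ (Sum.elim _ _ (succPoint a)) = _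
      rcases a with p | ⟨x, j, p | q⟩
      · have h : g.1.1 (outerPerm _ _ p) = g.1.1 p := g.1.2 p
        rcases letter_cases p with ⟨x, q, rfl⟩ | ⟨x, q, rfl⟩
        · rw [outerPerm_pos] at h
          simpa [succPoint, firstZ_pos, partner, arcFun, firstMatching] using h
        · rw [outerPerm_neg] at h
          simpa [succPoint, firstZ_neg, partner, arcFun, lastMatching] using h
      · cases j using Fin.lastCases with
        | last => simp [succPoint, arcFun]
        | cast i =>
          have h := (g.2 x i).2 p
          simpa [succPoint, arcFun, partner, innerPerm] using h
      · cases j using Fin.cases with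
        | zero => simp [succPoint, arcFun]
        | succ i => simp [succPoint, arcFun, partner]
    · rfl
  left_inv f := by
    have h (a : Point w κ) : arcFun σ (fun p => f.1 (Sum.inl (Sum.inl p)))
        (fun x j p => f.1 (Sum.inl (Sum.inr ⟨x, j.castSucc, Sum.inl p⟩))) a = f.1 (Sum.inl a) := by
      rcases a with p | ⟨x, j, p | q⟩
      · rfl
      · cases j using Fin.lastCases with
        | last => rw [invFun_next_arc]; simp [arcFun, succPoint]
        | cast i => simp [arcFun]
      · cases j using Fin.cases with
        | zero => rw [invFun_next_arc]; simp [arcFun, succPoint]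
        | succ i => rw [invFun_next_arc]; simp [arcFun, succPoint, partner]
    refine Subtype.ext (funext ?_)
    rintro (a | z)
    · exact h a
    · exact (h _).trans (f.2 (Sum.inr z))
  right_inv g := by
    refine Prod.ext rfl ?_
    ext x j p
    simp [arcFun]

/-- The circles have as many arcs as points and cancel. Of the $(\kappa_x+1)L_x$ matching-edges,
$\kappa_xL_x$ combine with the inner discs into lengths, and $L_x$ remain. -/
theorem eulerChar_surface (σ : MatchTuple w κ) :
    (surface σ).eulerChar = (cycleCount (outerPerm (firstMatching σ) (lastMatching σ)) : ℤ) -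
      ∑ x, (letterCount w x : ℤ) - ∑ x, ∑ j, (permLength (innerPerm σ x j) : ℤ) := by
  have hF : cycleCount (dartPerm σ) =
      cycleCount (outerPerm (firstMatching σ) (lastMatching σ)) +
        ∑ x, ∑ j, cycleCount (innerPerm σ x j) := by
    refine cycleCount_eq_of_card ?_
    rw [Nat.card_congr (faceFunEquiv σ), Nat.card_prod, card_invFun, Nat.card_pi]
    simp only [Nat.card_pi, card_invFun, Finset.prod_pow_eq_pow_sum, pow_add]
    simp
  have hV : Nat.card (surface σ).Vertex = Nat.card (Point w κ) := rfl
  have hE : Nat.card (surface σ).Edge = Nat.card (Point w κ) +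
      ∑ x, (κ x + 1) * letterCount w x := by
    change Nat.card (Point w κ ⊕ (Σ x : Fin r, Fin (κ x + 1) × PosLetter w x)) = _
    rw [Nat.card_sum]
    simp [Nat.card_eq_fintype_card, letterCount]
  have hlen (x : Fin r) (j : Fin (κ x)) : (permLength (innerPerm σ x j) : ℤ) =
      letterCount w x - cycleCount (innerPerm σ x j) := by
    have := permLength_add_cycleCount (innerPerm σ x j)
    rw [Nat.card_eq_fintype_card] at this
    rw [letterCount, ← this]
    simp
  have hface : Nat.card (surface σ).Face = cycleCount (dartPerm σ) := rfl
  rw [CellComplex.eulerChar, hface, hF, hV, hE]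
  simp only [hlen, Finset.sum_sub_distrib, Finset.sum_const, Finset.card_univ, Fintype.card_fin]
  push_cast
  simp only [add_mul, one_mul, Finset.sum_add_distrib, nsmul_eq_mul]
  ring

/-- The total length of a tuple of matchings. -/
noncomputable def tupleLength (σ : MatchTuple w κ) : ℕ :=
  ∑ x, ∑ j, permLength (innerPerm σ x j)

theorem RestrictedTuple.chi_eq (s : RestrictedTuple w) :
    s.chi = (cycleCount (outerPerm (firstMatching s.σ) (lastMatching s.σ)) : ℤ) -
      ∑ x, (letterCount w x : ℤ) - tupleLength s.σ := by
  rw [RestrictedTuple.chi, eulerChar_surface, tupleLength]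
  push_cast
  rfl

/-- Distinct neighbours make each `innerPerm` nontrivial, hence of length at least one. All
finiteness rests on this. -/
theorem RestrictedTuple.absKappa_le (s : RestrictedTuple w) : s.absKappa ≤ tupleLength s.σ := by
  refine Finset.sum_le_sum fun x _ => ?_
  calc s.κ x = ∑ _j : Fin (s.κ x), 1 := by simp
    _ ≤ _ := Finset.sum_le_sum fun j _ => permLength_pos fun h => s.adjacent_ne x j ?_
  ext1 p
  have := DFunLike.congr_fun h p
  rw [innerPerm, Equiv.trans_apply, Equiv.symm_apply_eq] at this
  exact this.symm

end EulerChar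

/-! ### Tuples of matchings and the coefficients of the inverse series -/

section PathSeries

theorem permLength_symm_trans {ι ι' : Type*} [Finite ι] (α β : ι ≃ ι') :
    permLength (α.trans β.symm) = permLength (β.trans α.symm) := by
  have h : (α.trans β.symm : Equiv.Perm ι) = (β.trans α.symm : Equiv.Perm ι)⁻¹ := by
    ext; simp
  rw [h, permLength, cycleCount_inv, permLength]

/-- The sign, the restrictions and the length of a sequence of bijections from `α` to `β`. -/
noncomputable def pathWeight {ι ι' : Type*} (α β : ι ≃ ι') (f : Σ k : ℕ, Fin (k + 1) → (ι ≃ ι')) :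
    PowerSeries ℂ :=
  open Classical in
  if f.2 0 = α ∧ f.2 (Fin.last _) = β ∧ ∀ j : Fin f.1, f.2 j.castSucc ≠ f.2 j.succ then
    (-1) ^ f.1 * PowerSeries.X ^
      ∑ j : Fin f.1, permLength ((f.2 j.succ).trans (f.2 j.castSucc).symm)
  else 0

variable {ι ι' : Type*} [Fintype ι] [DecidableEq ι] [Fintype ι'] [DecidableEq ι'] {t : ℂ}

/-- The inverse of $1+E$ is the geometric series in $-E$. Entries of $E$ are divisible by $X$, so
cutting off after the power $D$ is exact modulo $X^{D+1}$. -/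
theorem X_pow_dvd_sub_sum_pathWeight {W : Matrix (ι ≃ ι') (ι ≃ ι') (summableSeries t)}
    (hW : lengthMatrix t ι ι' * W = 1) (D : ℕ) (α β : ι ≃ ι') :
    (PowerSeries.X ^ (D + 1) : PowerSeries ℂ) ∣ (W α β).1 -
      ∑ f ∈ (Finset.range (D + 1)).sigma fun _ => Finset.univ, pathWeight α β f := by
  set L : Matrix (ι ≃ ι') (ι ≃ ι') (PowerSeries ℂ) :=
    (lengthMatrix t ι ι').map (summableSeries t).subtype with hL
  set V : Matrix (ι ≃ ι') (ι ≃ ι') (PowerSeries ℂ) := W.map (summableSeries t).subtype with hV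
  have hLV : L * V = 1 := by
    rw [hL, hV, ← Matrix.map_mul, hW, Matrix.map_one _ (map_zero _) (map_one _)]
  set E := L - 1 with hE
  have hEapply (γ δ : ι ≃ ι') : E γ δ =
      if γ ≠ δ then PowerSeries.X ^ permLength (δ.trans γ.symm) else 0 := by
    rw [hE, Matrix.sub_apply, hL, Matrix.map_apply, lengthMatrix, Matrix.of_apply, map_pow,
      permLength_symm_trans, Matrix.one_apply]
    by_cases h : γ = δ
    · subst h
      rw [if_pos rfl, if_neg (not_not.2 rfl), Equiv.self_trans_symm, ← Equiv.Perm.one_def,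
        permLength_one, pow_zero, sub_self]
    · rw [if_neg h, if_pos h, sub_zero]
      rfl
  have hdvd (k : ℕ) (γ δ : ι ≃ ι') : (PowerSeries.X ^ k : PowerSeries ℂ) ∣ (E ^ k) γ δ := by
    induction k generalizing γ with
    | zero => simp
    | succ k ih =>
      rw [pow_succ', pow_succ', Matrix.mul_apply]
      refine Finset.dvd_sum fun ε _ => mul_dvd_mul ?_ (ih ε)
      rw [hEapply]
      split_ifs with h
      · refine dvd_pow_self _ (permLength_pos fun h1 => h ?_).ne'
        ext a
        have := DFunLike.congr_fun h1 a
        rw [Equiv.trans_apply, Equiv.symm_apply_eq] at this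
        exact this.symm
      · exact dvd_zero _
  -- The zero diagonal of `E` is what imposes distinct neighbours on the paths.
  have hpow (k : ℕ) : ((-E) ^ k) α β = ∑ f : Fin (k + 1) → (ι ≃ ι'), pathWeight α β ⟨k, f⟩ := by
    rw [neg_pow, ← List.prod_replicate k E, ← List.ofFn_const, ← Int.cast_one, ← Int.cast_neg,
      ← Int.cast_pow, ← zsmul_eq_mul, Matrix.smul_apply, list_ofFn_prod_apply, Finset.smul_sum]
    refine Finset.sum_congr rfl fun f _ => ?_
    simp only [hEapply, Finset.prod_ite_zero, Finset.mem_univ, true_implies, pathWeight,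
      Finset.prod_pow_eq_pow_sum]
    rw [← ite_and, smul_ite, smul_zero, zsmul_eq_mul]
    simp only [and_assoc]
    push_cast
    congr
  have hgeom : V - ∑ k ∈ Finset.range (D + 1), (-E) ^ k = (-E) ^ (D + 1) * V := by
    have h1 := geom_sum_mul (-E) (D + 1)
    have h2 : -E - 1 = -L := by rw [hE]; abel
    rw [h2] at h1
    have h3 := congrArg (· * V) h1
    simp only [sub_mul, mul_assoc, neg_mul, hLV, one_mul, mul_neg, mul_one] at h3
    rw [eq_sub_iff_add_eq] at h3
    rw [← h3]
    abel
  have hentry := congrFun (congrFun hgeom α) β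
  rw [Matrix.sub_apply, Matrix.sum_apply] at hentry
  simp only [hpow] at hentry
  rw [Finset.sum_sigma]
  refine (show (PowerSeries.X ^ (D + 1) : PowerSeries ℂ) ∣ ((-E) ^ (D + 1) * V) α β from ?_).trans
    (dvd_of_eq hentry.symm)
  rw [Matrix.mul_apply, neg_pow, ← Int.cast_one, ← Int.cast_neg, ← Int.cast_pow, ← zsmul_eq_mul]
  refine Finset.dvd_sum fun ε _ => Dvd.dvd.mul_right ?_ _
  rw [Matrix.smul_apply, zsmul_eq_mul]
  exact (hdvd _ _ _).mul_left _

end PathSeries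

/-! ### Coefficients of the inverse series as signed counts of restricted tuples -/

section TupleSeries

variable {r ℓ : ℕ} {w : Fin ℓ → FreeGroup (Fin r)} {t : ℂ}

/-- A tuple of matchings as a family of sequences. -/
def RestrictedTuple.toPi (s : RestrictedTuple w) (x : Fin r) :
    Σ k : ℕ, Fin (k + 1) → Matching w x := ⟨s.κ x, s.σ x⟩

theorem RestrictedTuple.toPi_injective :
    Function.Injective (RestrictedTuple.toPi : RestrictedTuple w → _) := by
  rintro ⟨κ, σ, h⟩ ⟨κ', σ', h'⟩ he
  obtain rfl : κ = κ' := funext fun x => congrArg Sigma.fst (congrFun he x)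
  obtain rfl : σ = σ' := funext fun x => eq_of_heq (Sigma.mk.inj (congrFun he x)).2
  rfl

variable (w) in
/-- The families of sequences of bounded lengths. -/
def boundedPaths (D : ℕ) : Finset ((x : Fin r) → Σ k : ℕ, Fin (k + 1) → Matching w x) :=
  Fintype.piFinset fun _ => (Finset.range (D + 1)).sigma fun _ => Finset.univ

theorem RestrictedTuple.toPi_mem_boundedPaths {s : RestrictedTuple w} {D : ℕ}
    (h : tupleLength s.σ ≤ D) : s.toPi ∈ boundedPaths w D := by
  refine Fintype.mem_piFinset.2 fun x => Finset.mem_sigma.2 ⟨?_, Finset.mem_univ _⟩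
  refine Finset.mem_range.2 (Nat.lt_succ_of_le ?_)
  exact (Finset.single_le_sum (f := s.κ) (fun _ _ => Nat.zero_le _) (Finset.mem_univ x)).trans
    (s.absKappa_le.trans h)

theorem finite_tupleLength_le (D : ℕ) : {s : RestrictedTuple w | tupleLength s.σ ≤ D}.Finite :=
  Set.Finite.of_injOn (f := RestrictedTuple.toPi) (t := boundedPaths w D)
    (fun _ h => RestrictedTuple.toPi_mem_boundedPaths h) RestrictedTuple.toPi_injective.injOn
    (Finset.finite_toSet _)

/-- The tuples of given length between given first and last matchings. -/
def tuplesBetween (α β : (x : Fin r) → Matching w x) (d : ℕ) : Set (RestrictedTuple w) :=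
  {s | firstMatching s.σ = α ∧ lastMatching s.σ = β ∧ tupleLength s.σ = d}

theorem finite_tuplesBetween (α β : (x : Fin r) → Matching w x) (d : ℕ) :
    (tuplesBetween α β d).Finite :=
  (finite_tupleLength_le d).subset fun _ h => h.2.2.le

/-- The coefficient of $X^d$ only sees the factors modulo $X^{d+1}$, so each may be replaced by its
finite path sum; no tuple is lost, since total length `d` bounds every `κ x` by `d`. -/
theorem coeff_prod_eq (W : (x : Fin r) → Matrix (Matching w x) (Matching w x) (summableSeries t))
    (hW : ∀ x, lengthMatrix t (PosLetter w x) (NegLetter w x) * W x = 1)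
    (α β : (x : Fin r) → Matching w x) (d : ℕ) :
    PowerSeries.coeff d (∏ x, (W x (α x) (β x)).1) =
      ∑ᶠ s ∈ tuplesBetween α β d, (-1 : ℂ) ^ s.absKappa := by
  classical
  have hdvd : (PowerSeries.X ^ (d + 1) : PowerSeries ℂ) ∣ ∏ x, (W x (α x) (β x)).1 -
      ∏ x, ∑ f ∈ (Finset.range (d + 1)).sigma fun _ => Finset.univ,
        pathWeight (α x) (β x) f := by
    rw [← Ideal.mem_span_singleton, ← Ideal.Quotient.eq, map_prod, map_prod]
    refine Finset.prod_congr rfl fun x _ => ?_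
    rw [Ideal.Quotient.eq, Ideal.mem_span_singleton]
    exact X_pow_dvd_sub_sum_pathWeight (hW x) d (α x) (β x)
  have hcoeff := PowerSeries.X_pow_dvd_iff.1 hdvd d d.lt_succ_self
  rw [map_sub, sub_eq_zero] at hcoeff
  rw [hcoeff, Finset.prod_univ_sum, map_sum, finsum_mem_eq_finite_toFinset_sum _
    (finite_tuplesBetween α β d)]
  have hterm (F : (x : Fin r) → Σ k : ℕ, Fin (k + 1) → Matching w x) :
      PowerSeries.coeff d (∏ x, pathWeight (α x) (β x) (F x)) =
      if (∀ x, (F x).2 0 = α x ∧ (F x).2 (Fin.last _) = β x ∧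
          ∀ j : Fin (F x).1, (F x).2 j.castSucc ≠ (F x).2 j.succ) ∧
        ∑ x, ∑ j : Fin (F x).1, permLength (((F x).2 j.succ).trans ((F x).2 j.castSucc).symm) = d
      then (-1 : ℂ) ^ ∑ x, (F x).1 else 0 := by
    by_cases h1 : ∀ x, (F x).2 0 = α x ∧ (F x).2 (Fin.last _) = β x ∧
        ∀ j : Fin (F x).1, (F x).2 j.castSucc ≠ (F x).2 j.succ
    · have hC : ((-1 : PowerSeries ℂ) ^ ∑ x, (F x).1) =
          PowerSeries.C ((-1 : ℂ) ^ ∑ x, (F x).1) := by simp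
      have hx (x : Fin r) : pathWeight (α x) (β x) (F x) = _ := if_pos (h1 x)
      simp only [hx]
      rw [Finset.prod_mul_distrib,
        Finset.prod_pow_eq_pow_sum, Finset.prod_pow_eq_pow_sum, hC, PowerSeries.coeff_C_mul,
        PowerSeries.coeff_X_pow, mul_ite_zero, mul_one]
      exact if_congr (by rw [eq_comm]; exact (and_iff_right h1).symm) rfl rfl
    · rw [if_neg fun h => h1 h.1]
      obtain ⟨x, hx⟩ := not_forall.1 h1
      rw [Finset.prod_eq_zero (Finset.mem_univ x) (if_neg hx), map_zero]
  simp only [hterm]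
  rw [← Finset.sum_filter]
  symm
  refine Finset.sum_bij (fun s _ => s.toPi) (fun s hs => ?_)
    (fun s _ s' _ h => RestrictedTuple.toPi_injective h) (fun F hF => ?_) fun s _ => rfl
  · obtain ⟨h1, h2, h3⟩ := (Set.Finite.mem_toFinset _).1 hs
    refine Finset.mem_filter.2 ⟨RestrictedTuple.toPi_mem_boundedPaths h3.le, fun x => ?_, h3⟩
    exact ⟨congrFun h1 x, congrFun h2 x, s.adjacent_ne x⟩
  · obtain ⟨-, h1, h2⟩ := Finset.mem_filter.1 hF
    refine ⟨⟨fun x => (F x).1, fun x => (F x).2, fun x => (h1 x).2.2⟩,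
      (Set.Finite.mem_toFinset _).2 ⟨?_, ?_, h2⟩, rfl⟩
    · exact funext fun x => (h1 x).1
    · exact funext fun x => (h1 x).2.1

end TupleSeries

/-! ### The Laurent series -/

section Laurent

variable {r ℓ : ℕ} {w : Fin ℓ → FreeGroup (Fin r)}

/-- The number of outer cycles is at most the number of letters, so fixing $\chi$ bounds the total
length. -/
theorem finite_chi_eq (χ₀ : ℤ) : {s : RestrictedTuple w | s.chi = χ₀}.Finite := by
  refine (finite_tupleLength_le (w := w) (Nat.card (Letter w) + χ₀.natAbs)).subset fun s hs => ?_
  have h1 := s.chi_eq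
  have h2 := cycleCount_le_card (outerPerm (firstMatching s.σ) (lastMatching s.σ))
  have h3 : 0 ≤ ∑ x, (letterCount w x : ℤ) := Finset.sum_nonneg fun _ _ => Int.natCast_nonneg _
  rw [Set.mem_ofPred_eq] at hs ⊢
  omega

theorem hasSum_tuplesBetween {n : ℕ} (hn : 0 < n)
    (W : (x : Fin r) → Matrix (Matching w x) (Matching w x) (summableSeries (n : ℂ)⁻¹))
    (hW : ∀ x, lengthMatrix (n : ℂ)⁻¹ (PosLetter w x) (NegLetter w x) * W x = 1)
    (α β : (x : Fin r) → Matching w x) :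
    HasSum (fun χ₀ : ℤ => ∑ᶠ s ∈ {s : RestrictedTuple w | s.chi = χ₀ ∧
        firstMatching s.σ = α ∧ lastMatching s.σ = β},
          (-1 : ℂ) ^ s.absKappa * (n : ℂ) ^ s.chi)
      ((n : ℂ) ^ cycleCount (outerPerm α β) *
        ∏ x, ((n : ℂ) ^ letterCount w x)⁻¹ * evalSeries (n : ℂ)⁻¹ (W x (α x) (β x))) := by
  have hn0 : (n : ℂ) ≠ 0 := Nat.cast_ne_zero.2 hn.ne'
  set N : ℤ := (cycleCount (outerPerm α β) : ℤ) - ∑ x, (letterCount w x : ℤ) with hN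
  have hinj : Function.Injective fun d : ℕ => N - d := fun a b h => by
    simpa using h
  -- With both end matchings fixed, $\chi=N-d$ with `d` the total length, so the sum over $\chi_0$
  -- is a power series in $1/n$; other values of $\chi_0$ carry no tuples.
  rw [← hinj.hasSum_iff fun χ₀ hχ => ?_]
  · have hval : (n : ℂ) ^ cycleCount (outerPerm α β) *
        ∏ x, ((n : ℂ) ^ letterCount w x)⁻¹ * evalSeries (n : ℂ)⁻¹ (W x (α x) (β x)) =
        (n : ℂ) ^ N * evalSeries (n : ℂ)⁻¹ (∏ x, W x (α x) (β x)) := by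
      rw [hN, zpow_sub₀ hn0, zpow_natCast, ← Nat.cast_sum, zpow_natCast,
        ← Finset.prod_pow_eq_pow_sum, map_prod, Finset.prod_mul_distrib, Finset.prod_inv_distrib]
      ring
    rw [hval]
    refine ((hasSum_evalSeries (∏ x, W x (α x) (β x))).mul_left ((n : ℂ) ^ N)).congr_fun ?_
    intro d
    have hset : {s : RestrictedTuple w | s.chi = N - d ∧ firstMatching s.σ = α ∧
        lastMatching s.σ = β} = tuplesBetween α β d := by
      ext s
      have h1 := s.chi_eq
      constructor
      · rintro ⟨h2, rfl, rfl⟩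
        refine ⟨rfl, rfl, ?_⟩
        omega
      · rintro ⟨rfl, rfl, h2⟩
        refine ⟨?_, rfl, rfl⟩
        omega
    have hprod : (∏ x, W x (α x) (β x)).1 = ∏ x, (W x (α x) (β x)).1 :=
      map_prod (summableSeries (n : ℂ)⁻¹).subtype _ _
    rw [Function.comp_apply, hset, hprod, coeff_prod_eq W hW, finsum_mem_mul, mul_finsum_mem]
    refine finsum_mem_congr rfl fun s hs => ?_
    rw [← hset] at hs
    rw [hs.1, zpow_sub₀ hn0, zpow_natCast, inv_pow]
    ring
  · refine finsum_mem_eq_zero_of_forall_eq_zero fun s hs => absurd ?_ hχ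
    obtain ⟨h2, rfl, rfl⟩ := hs
    have h1 := s.chi_eq
    exact ⟨tupleLength s.σ, by beta_reduce; omega⟩

end Laurent

end WordIntegral

/-! ### Assembly of the expansion -/

theorem theorem2p6 {r ℓ : ℕ} (hℓ : 1 ≤ ℓ) (w : Fin ℓ → FreeGroup (Fin r))
    (hw : ∀ i, w i ≠ 1) (hbal : WordIntegral.Balanced w) :
    (∀ χ₀ : ℤ, {s : WordIntegral.RestrictedTuple w | s.chi = χ₀}.Finite) ∧
    ∀ n : ℕ, (∀ x : Fin r, WordIntegral.letterCount w x ≤ n) →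
      HasSum
        (fun χ₀ : ℤ => ∑ᶠ s ∈ {s : WordIntegral.RestrictedTuple w | s.chi = χ₀},
          (-1 : ℂ) ^ s.absKappa * (n : ℂ) ^ s.chi)
        (WordIntegral.expTrace w n) := by
  open WordIntegral in
  refine ⟨finite_chi_eq, fun n hcard => ?_⟩
  -- The first word has a letter, so by balance some $L_x$ is positive, and it is at most `n`.
  have hn : 0 < n := by
    obtain ⟨x, hx⟩ : ∃ x, 0 < letterCount w x := by
      have hlen : 0 < (w ⟨0, hℓ⟩).toWord.length := by
        simpa [List.length_pos_iff, FreeGroup.toWord_eq_nil_iff] using hw ⟨0, hℓ⟩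
      rcases letter_cases (⟨⟨0, hℓ⟩, ⟨0, hlen⟩⟩ : Letter w) with ⟨x, q, -⟩ | ⟨x, q, -⟩
      · exact ⟨x, Fintype.card_pos_iff.2 ⟨q⟩⟩
      · exact ⟨x, (Fintype.card_pos_iff.2 ⟨q⟩).trans_eq (hbal x).symm⟩
    exact hx.trans_le (hcard x)
  have hinv (x : Fin r) : ∃ W, lengthMatrix (n : ℂ)⁻¹ (PosLetter w x) (NegLetter w x) * W = 1 := by
    refine exists_inverse_lengthMatrix _ _ fun m hm => ?_
    have hmn : (m : ℝ) < n := Nat.cast_lt.2 (hm.trans_le (hcard x))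
    rw [norm_inv, Complex.norm_natCast, ← div_eq_mul_inv]
    exact (div_lt_one (Nat.cast_pos.2 hn)).2 hmn
  choose W hW using hinv
  rw [expTrace_eq hw hbal hn hcard W hW]
  have h := hasSum_sum (s := Finset.univ) fun α _ => hasSum_sum (s := Finset.univ) fun β _ =>
    hasSum_tuplesBetween hn W hW α β
  refine h.congr_fun fun χ₀ => ?_
  classical
  have hfin (α β : (x : Fin r) → Matching w x) : {s : RestrictedTuple w | s.chi = χ₀ ∧
      firstMatching s.σ = α ∧ lastMatching s.σ = β}.Finite :=
    (finite_chi_eq χ₀).subset fun _ hs => hs.1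
  -- The finitely many tuples with this $\chi$ are sorted by their first and last matchings.
  rw [finsum_mem_eq_finite_toFinset_sum _ (finite_chi_eq χ₀), ← Finset.sum_fiberwise _
    (fun s : RestrictedTuple w => firstMatching s.σ)]
  refine Finset.sum_congr rfl fun α _ => ?_
  rw [← Finset.sum_fiberwise _ (fun s : RestrictedTuple w => lastMatching s.σ)]
  refine Finset.sum_congr rfl fun β _ => ?_
  rw [finsum_mem_eq_finite_toFinset_sum _ (hfin α β)]
  refine Finset.sum_congr ?_ fun _ _ => rfl
  ext s
  simp [and_assoc]
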